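/- Fix $\delta>0$ and $K\ge 0$. For each $k\ge 1$ let $\mathbf r_k\in\mathbb R^{m_k}$, $\mathbf c_k\in\mathbb R^{n_k}$ be vectors with $\sum_i\mathbf r_k(i)=\sum_j\mathbf c_k(j)=N_k>0$ that are $\delta$-smooth, i.e. $\frac{\delta N_k}{m_k}\le \mathbf r_k(i)\le\frac{N_k}{\delta m_k}$ and $\frac{\delta N_k}{n_k}\le \mathbf c_k(j)\le\frac{N_k}{\delta n_k}$ for all $i,j$, and let $\boldsymbol\Lambda_k\in\mathbb R_{>0}^{m_k\times n_k}$. Define on $[0,1]$ and $[0,1]^2$ the histogram densities $$\rho_{\mathbf r_k}(x)=\tfrac{m_k}{N_k}\mathbf r_k(\lceil m_kx\rceil),\quad \rho_{\mathbf c_k}(y)=\tfrac{n_k}{N_k}\mathbf c_k(\lceil n_ky\rceil),\quad \varphi_{\boldsymbol\Lambda_k}(x,y)=\tfrac{m_kn_k}{N_k}\boldsymbol\Lambda_k(\lceil m_kx\rceil,\lceil n_ky\rceil),$$ and the measures $\mu_0^k=\rho_{\mathbf r_k}dx$, $\mu_1^k=\rho_{\mathbf c_k}dy$, $\mathcal R_k=\varphi_{\boldsymbol\Lambda_k}dx\,dy$.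 Suppose that there are probability measures $\mu_0=\rho_{\mathbf r}dx$, $\mu_1=\rho_{\mathbf c}dy$ on $[0,1]$ and $\mathcal R=\varphi_{\boldsymbol\Lambda}dx\,dy$ on $[0,1]^2$ with $\rho_{\mathbf r_k}\to\rho_{\mathbf r}$, $\rho_{\mathbf c_k}\to\rho_{\mathbf c}$ and $\varphi_{\boldsymbol\Lambda_k}\to\varphi_{\boldsymbol\Lambda}$ in $L^1$, and that for all sufficiently large $k$ the bounded-cost condition $$\Bigl|\log\frac{\mathbf r_k(i)\,\mathbf c_k(j)\,\|\boldsymbol\Lambda_k\|_1}{\boldsymbol\Lambda_k(i,j)\,N_k^2}\Bigr|\le K\qquad\text{for all } i,j \tag{$*$}$$ holds, where $\|\boldsymbol\Lambda_k\|_1=\sum_{i,j}|\boldsymbol\Lambda_k(i,j)|$. For probability measures $\nu_0,\nu_1$ on $[0,1]$ and a finite measure $\mathcal Q$ on $[0,1]^2$, a static Schrödinger bridge with margins $\nu_0,\nu_1$ and reference measure $\mathcal Q$ is a minimizer of the relative entropy $D_{\mathrm{KL}}(\pi\,\Vert\,\mathcal Q)=\int\log\frac{d\pi}{d\mathcal Q}\,d\pi$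 (equal to $+\infty$ if $\pi\not\ll\mathcal Q$) over all couplings $\pi$ of $\nu_0$ and $\nu_1$. For finite measures $P,Q$ dominated by $\sigma$ let $d_H(P,Q)=\bigl(\int(\sqrt{dP/d\sigma}-\sqrt{dQ/d\sigma})^2d\sigma\bigr)^{1/2}$, which does not depend on $\sigma$. Then for every $k$ there is exactly one static Schrödinger bridge $\pi_k$ with margins $\mu_0^k,\mu_1^k$ and reference measure $\mathcal R_k$, and there is exactly one static Schrödinger bridge $\pi$ with margins $\mu_0,\mu_1$ and reference measure $\mathcal R$. For every $k$ for which $(*)$ holds (hence for all sufficiently large $k$), $$d_H(\pi_k,\pi)^2\le 8\bigl(K+4\log\delta^{-1}\bigr)\bigl(\|\rho_{\mathbf r_k}-\rho_{\mathbf r}\|_{L^1}+\|\rho_{\mathbf c_k}-\rho_{\mathbf c}\|_{L^1}\bigr)+4e^{3K}\delta^{-12}\,d_H(\mathcal R_k,\mathcal R)^2 .$$ In particular $d_H(\pi_k,\pi)\to0$ as $k\to\infty$. -/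

import Mathlib

open MeasureTheory Filter Topology

noncomputable section

namespace SchrodingerBridge

/-- The margin `(r, c)` is positive in total, balanced, and `δ`-smooth: with `N = ∑ r = ∑ c`,
`δ N / m ≤ r i ≤ N / (δ m)` and `δ N / n ≤ c j ≤ N / (δ n)`. -/
structure IsSmoothMargin (δ : ℝ) {m n : ℕ} (r : Fin m → ℝ) (c : Fin n → ℝ) : Prop where
  total_pos : 0 < ∑ i, r i
  balanced : ∑ i, r i = ∑ j, c j
  row_bounds : ∀ i, δ * (∑ i, r i) / m ≤ r i ∧ r i ≤ (∑ i, r i) / (δ * m)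
  col_bounds : ∀ j, δ * (∑ j, c j) / n ≤ c j ∧ c j ≤ (∑ j, c j) / (δ * n)

/-- The entrywise `ℓ¹` norm of a matrix. -/
def entryNorm {m n : ℕ} (L : Matrix (Fin m) (Fin n) ℝ) : ℝ := ∑ i, ∑ j, |L i j|

/-- Bounded cost: `|log (r i c j ‖L‖₁ / (L i j N²))| ≤ K` for all `i, j`, where `N = ∑ r`. -/
def HasBoundedCost (K : ℝ) {m n : ℕ} (r : Fin m → ℝ) (c : Fin n → ℝ)
    (L : Matrix (Fin m) (Fin n) ℝ) : Prop :=
  ∀ i j, |Real.log (r i * c j * entryNorm L / (L i j * (∑ i, r i) ^ 2))| ≤ K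

/-- The histogram density `x ↦ (m / N) v ⌈m x⌉` on `[0,1]`, where `N = ∑ v`. Entries are indexed
from `0`, so that the entry with (one-based) number `⌈m x⌉` is `v i` with `i + 1 = ⌈m x⌉`. (At the
null point `x = 0`, where the index is out of range, the value is `0`.) -/
def marginDensity {m : ℕ} (v : Fin m → ℝ) (x : unitInterval) : ℝ :=
  m / (∑ i, v i) * ∑ i : Fin m, if ⌈(m : ℝ) * (x : ℝ)⌉₊ = (i : ℕ) + 1 then v i else 0

/-- The histogram density `(x, y) ↦ (n m / N) L (⌈m x⌉, ⌈n y⌉)` on `[0,1]²`; the normalization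
`N` is the total sum of the margin, not of `L`. -/
def kernelDensity (N : ℝ) {m n : ℕ} (L : Matrix (Fin m) (Fin n) ℝ)
    (p : unitInterval × unitInterval) : ℝ :=
  (n * m : ℝ) / N * ∑ i : Fin m, ∑ j : Fin n,
    if ⌈(m : ℝ) * (p.1 : ℝ)⌉₊ = (i : ℕ) + 1 ∧ ⌈(n : ℝ) * (p.2 : ℝ)⌉₊ = (j : ℕ) + 1
    then L i j else 0

/-- `f` is a probability density with respect to the canonical (Lebesgue) measure. -/
structure IsProbDensity {α : Type*} [MeasureSpace α] (f : α → ℝ) : Prop where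
  integrable : Integrable f volume
  nonneg : ∀ᵐ x ∂(volume : Measure α), 0 ≤ f x
  integral_eq_one : ∫ x, f x = 1

/-- The measure `f dx`. -/
def densityMeasure {α : Type*} [MeasureSpace α] (f : α → ℝ) : Measure α :=
  (volume : Measure α).withDensity fun x => ENNReal.ofReal (f x)

/-- The measure on `[0,1]` whose density is the histogram of the margin vector `v`. -/
def marginMeasure {m : ℕ} (v : Fin m → ℝ) : Measure unitInterval :=
  densityMeasure (marginDensity v)

/-- The measure on `[0,1]²` whose density is the histogram of the matrix `L`, scaled by `N`. -/
def kernelMeasure (N : ℝ) {m n : ℕ} (L : Matrix (Fin m) (Fin n) ℝ) :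
    Measure (unitInterval × unitInterval) :=
  densityMeasure (kernelDensity N L)

/-- The `L¹` distance `‖f - g‖_{L¹}` with respect to the canonical (Lebesgue) measure. -/
def distL1 {α : Type*} [MeasureSpace α] (f g : α → ℝ) : ℝ := ∫ x, |f x - g x|

/-- The Hellinger distance `(∫ (√(dμ/dσ) - √(dν/dσ))² dσ)^{1/2}` of two finite measures. It does
not depend on the base measure `σ` dominating `μ` and `ν`; here `σ = μ + ν`. -/
def hellingerDist {α : Type*} [MeasurableSpace α] (μ ν : Measure α) : ℝ :=
  √(∫ x, (√(μ.rnDeriv (μ + ν) x).toReal - √(ν.rnDeriv (μ + ν) x).toReal) ^ 2 ∂(μ + ν))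

/-- `π` is a coupling of `μ₀` and `μ₁`, i.e. `π ∈ Π(μ₀, μ₁)`. -/
def IsCoupling {α β : Type*} [MeasurableSpace α] [MeasurableSpace β]
    (μ₀ : Measure α) (μ₁ : Measure β) (π : Measure (α × β)) : Prop :=
  π.map Prod.fst = μ₀ ∧ π.map Prod.snd = μ₁

/-- `π` is a static Schrödinger bridge: it minimizes the relative entropy `D_KL(· ‖ R)` over all
couplings of `μ₀` and `μ₁`. For a coupling `H` of probability measures,
`klDiv H R = ∫ log (dH/dR) dH + (R(univ) - 1)`, whose last term does not depend on `H`, so that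
the minimizers are those of `∫ log (dH/dR) dH`. -/
def IsBridge {α β : Type*} [MeasurableSpace α] [MeasurableSpace β]
    (μ₀ : Measure α) (μ₁ : Measure β) (R π : Measure (α × β)) : Prop :=
  IsCoupling μ₀ μ₁ π ∧
    ∀ H, IsCoupling μ₀ μ₁ H → InformationTheory.klDiv π R ≤ InformationTheory.klDiv H R

end SchrodingerBridge

end

open SchrodingerBridge

open MeasureTheory Filter Topology

noncomputable section

/-! Write `φ` for the density of the reference measure, normalized to mass one, and `ρ₀`, `ρ₁` for
the margin densities. The bounded-cost condition says exactly that `φ / (ρ₀ ⊗ ρ₁)` lies in `[exp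
(-K), exp K]` (`kernelDensity_bounds`), and this survives the `L¹` limit along an a.e. convergent
subsequence (`hasBoundedRatio_of_tendsto`). So a single statement, `HasBoundedRatio`, covers the
approximating problems and the limit problem.

Under a bounded ratio the Schrödinger system for the potentials `a`, `b` is solved by Sinkhorn
iteration. A kernel with values in `[l, u]` contracts the oscillation of ratios of positive
functions by `1 - l / u`, so the iterates, pinned at one point, converge geometrically
(`exists_schrodinger_system`). The solution satisfies `a ∈ [exp (-K), exp K]`, `b ∈ [exp (-2K), exp
(2K)]` and `a b ≤ exp (3K)`. On couplings, the entropies relative to `R` and to `a ⊗ b · R` differ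
by a constant, because `log a + log b` integrates to a value fixed by the margins. Hence `a ⊗ b · R`
is the only bridge (`isBridge_scaledMeasure`).

Stability rests on the pointwise inequality `sq_sqrt_mul_sub_le`. Apply it with `A = a b`, `B = a'
b'` and integrate. The factor `log A - log B` is a function of `x` plus a function of `y`, so its
integral against the difference of the two couplings sees only the differences of the margins, and
it is bounded through the bounds on the potentials. What remains is `exp (3K)` times the squared
Hellinger distance of the references; normalizing the approximating reference costs another factor
`2` (`integral_sq_sqrt_sub_div_le`). The resulting constants `4 K` and `(8/3) exp (3K)` are below
the stated ones since `δ ≤ 1`. -/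

namespace SchrodingerBridge

/-! ### Ratio bounds and their contraction by positive integral operators. -/

section Potentials

/-- `f / g` takes values in an interval `[m, (1 + ρ) m]` with `m > 0`. -/
def RatioBound {ι : Type*} (ρ : ℝ) (f g : ι → ℝ) : Prop :=
  ∃ m, 0 < m ∧ ∀ x, m * g x ≤ f x ∧ f x ≤ (1 + ρ) * m * g x

lemma RatioBound.inv {ι : Type*} {ρ : ℝ} {f g : ι → ℝ} (h : RatioBound ρ f g) (hρ : 0 ≤ ρ)
    (hf : ∀ x, 0 < f x) (hg : ∀ x, 0 < g x) :
    RatioBound ρ (fun x => (f x)⁻¹) (fun x => (g x)⁻¹) := by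
  obtain ⟨m, hm, h⟩ := h
  have h1 : 0 < 1 + ρ := by linarith
  refine ⟨((1 + ρ) * m)⁻¹, by positivity, fun x => ⟨?_, ?_⟩⟩
  · rw [← mul_inv]
    exact inv_anti₀ (hf x) (h x).2
  · have : (1 + ρ) * ((1 + ρ) * m)⁻¹ * (g x)⁻¹ = (m * g x)⁻¹ := by
      have := hg x
      field_simp
    rw [this]
    exact inv_anti₀ (mul_pos hm (hg x)) (h x).1

lemma RatioBound.const_mul {ι : Type*} {ρ s t : ℝ} {f g : ι → ℝ} (h : RatioBound ρ f g) (hs : 0 < s)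
    (ht : 0 < t) : RatioBound ρ (fun x => s * f x) (fun x => t * g x) := by
  obtain ⟨m, hm, h⟩ := h
  refine ⟨s * m / t, by positivity, fun x => ⟨?_, ?_⟩⟩
  · calc s * m / t * (t * g x) = s * (m * g x) := by field_simp
      _ ≤ s * f x := mul_le_mul_of_nonneg_left (h x).1 hs.le
  · calc s * f x ≤ s * ((1 + ρ) * m * g x) := mul_le_mul_of_nonneg_left (h x).2 hs.le
      _ = (1 + ρ) * (s * m / t) * (t * g x) := by field_simp

/-- Two functions that agree at a point and have nearly constant ratio are close. -/
lemma RatioBound.abs_sub_le {ι : Type*} {ρ : ℝ} {f g : ι → ℝ} (h : RatioBound ρ f g) (hρ : 0 ≤ ρ)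
    (hg : ∀ x, 0 < g x) {x₀ : ι} (h0 : f x₀ = 1) (h0' : g x₀ = 1) (x : ι) :
    |f x - g x| ≤ ρ * g x := by
  obtain ⟨m, hm, h⟩ := h
  have h1 : m ≤ 1 := by simpa [h0, h0'] using (h x₀).1
  have h2 : 1 ≤ (1 + ρ) * m := by simpa [h0, h0'] using (h x₀).2
  have h3 := hg x
  rw [abs_le]
  constructor
  · have : (1 - ρ) * g x ≤ m * g x := by
      apply mul_le_mul_of_nonneg_right _ h3.le
      nlinarith
    linarith [(h x).1]
  · have : (1 + ρ) * m * g x ≤ (1 + ρ) * g x := by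
      apply mul_le_mul_of_nonneg_right _ h3.le
      nlinarith
    linarith [(h x).2]

variable {α X Y : Type*} [MeasurableSpace α] [MeasurableSpace X] [MeasurableSpace Y]

/-- `f` is measurable with values in `[l, u]`, where `l > 0`. -/
structure IsPosBdd (l u : ℝ) (f : α → ℝ) : Prop where
  measurable : Measurable f
  lower_pos : 0 < l
  lower : ∀ x, l ≤ f x
  upper : ∀ x, f x ≤ u

namespace IsPosBdd

variable {l u l' u' : ℝ} {f g : α → ℝ}

lemma pos (hf : IsPosBdd l u f) (x : α) : 0 < f x := hf.lower_pos.trans_le (hf.lower x)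

lemma upper_pos [Nonempty α] (hf : IsPosBdd l u f) : 0 < u :=
  (hf.pos (Classical.arbitrary α)).trans_le (hf.upper _)

lemma abs_le (hf : IsPosBdd l u f) (x : α) : |f x| ≤ u := by
  rw [abs_of_pos (hf.pos x)]; exact hf.upper x

lemma integrable (hf : IsPosBdd l u f) (μ : Measure α) [IsFiniteMeasure μ] : Integrable f μ :=
  Integrable.of_bound hf.measurable.aestronglyMeasurable u (ae_of_all _ hf.abs_le)

lemma inv [Nonempty α] (hf : IsPosBdd l u f) : IsPosBdd u⁻¹ l⁻¹ (fun x => (f x)⁻¹) where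
  measurable := hf.measurable.inv
  lower_pos := inv_pos.2 hf.upper_pos
  lower x := inv_anti₀ (hf.pos x) (hf.upper x)
  upper x := inv_anti₀ hf.lower_pos (hf.lower x)

lemma mul (hf : IsPosBdd l u f) (hg : IsPosBdd l' u' g) :
    IsPosBdd (l * l') (u * u') (fun x => f x * g x) where
  measurable := hf.measurable.mul hg.measurable
  lower_pos := mul_pos hf.lower_pos hg.lower_pos
  lower x := mul_le_mul (hf.lower x) (hg.lower x) hg.lower_pos.le (hf.pos x).le
  upper x := mul_le_mul (hf.upper x) (hg.upper x) (hg.pos x).le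
    ((hf.pos x).le.trans (hf.upper x))

lemma const_mul (hf : IsPosBdd l u f) {c : ℝ} (hc : 0 < c) :
    IsPosBdd (c * l) (c * u) (fun x => c * f x) where
  measurable := hf.measurable.const_mul c
  lower_pos := mul_pos hc hf.lower_pos
  lower x := mul_le_mul_of_nonneg_left (hf.lower x) hc.le
  upper x := mul_le_mul_of_nonneg_left (hf.upper x) hc.le

lemma comp {β : Type*} [MeasurableSpace β] (hf : IsPosBdd l u f) {h : β → α} (hh : Measurable h) :
    IsPosBdd l u (fun x => f (h x)) where
  measurable := hf.measurable.comp hh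
  lower_pos := hf.lower_pos
  lower _ := hf.lower _
  upper _ := hf.upper _

lemma le_integral (hf : IsPosBdd l u f) (μ : Measure α) [IsProbabilityMeasure μ] :
    l ≤ ∫ x, f x ∂μ := by
  simpa using integral_mono (integrable_const l) (hf.integrable μ) hf.lower

lemma integral_le (hf : IsPosBdd l u f) (μ : Measure α) [IsProbabilityMeasure μ] :
    ∫ x, f x ∂μ ≤ u := by
  simpa using integral_mono (hf.integrable μ) (integrable_const u) hf.upper

lemma integral_pos (hf : IsPosBdd l u f) (μ : Measure α) [IsProbabilityMeasure μ] :
    0 < ∫ x, f x ∂μ := hf.lower_pos.trans_le (hf.le_integral μ)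

end IsPosBdd

/-- The integral operator with kernel `k`. -/
def kernelOp (ν : Measure Y) (k : X → Y → ℝ) (b : Y → ℝ) (x : X) : ℝ := ∫ y, k x y * b y ∂ν

variable {l u c C : ℝ} {k : X → Y → ℝ} {b b' : Y → ℝ}

lemma IsPosBdd.kernel_mul (hk : IsPosBdd l u (Function.uncurry k)) (hb : IsPosBdd c C b) (x : X) :
    IsPosBdd (l * c) (u * C) (fun y => k x y * b y) :=
  (hk.comp (measurable_prodMk_left (x := x))).mul hb

lemma IsPosBdd.swap (hk : IsPosBdd l u (Function.uncurry k)) :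
    IsPosBdd l u (Function.uncurry fun y x => k x y) :=
  hk.comp measurable_swap

lemma IsPosBdd.kernelOp (ν : Measure Y) [IsProbabilityMeasure ν]
    (hk : IsPosBdd l u (Function.uncurry k)) (hb : IsPosBdd c C b) :
    IsPosBdd (l * ∫ y, b y ∂ν) (u * ∫ y, b y ∂ν) (kernelOp ν k b) where
  measurable := by
    refine (StronglyMeasurable.integral_prod_right (f := fun x y => k x y * b y) ?_).measurable
    exact (hk.measurable.mul (hb.measurable.comp measurable_snd)).stronglyMeasurable
  lower_pos := mul_pos hk.lower_pos (hb.integral_pos ν)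
  lower x := by
    rw [← integral_const_mul]
    exact integral_mono ((hb.integrable ν).const_mul _) ((hk.kernel_mul hb x).integrable ν)
      fun y => mul_le_mul_of_nonneg_right (hk.lower (x, y)) (hb.pos y).le
  upper x := by
    rw [← integral_const_mul]
    exact integral_mono ((hk.kernel_mul hb x).integrable ν) ((hb.integrable ν).const_mul _)
      fun y => mul_le_mul_of_nonneg_right (hk.upper (x, y)) (hb.pos y).le

/-- A positive integral operator contracts ratios (a form of the Birkhoff–Hopf theorem). -/
lemma RatioBound.kernelOp {c' C' ρ : ℝ} (ν : Measure Y) [IsProbabilityMeasure ν]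
    (hk : IsPosBdd l u (Function.uncurry k)) (hlu : l ≤ u)
    (hb : IsPosBdd c C b) (hb' : IsPosBdd c' C' b')
    (hρ : 0 ≤ ρ) (h : RatioBound ρ b b') :
    RatioBound ((1 - l / u) * ρ) (kernelOp ν k b) (kernelOp ν k b') := by
  obtain ⟨m, hm, h⟩ := h
  have hl := hk.lower_pos
  have hu : 0 < u := hl.trans_le hlu
  set J := ∫ y, b' y ∂ν with hJ
  have hJ0 : 0 < J := hb'.integral_pos ν
  -- `I` is the mean ratio of `b` to `b'`. Applying the kernel moves both ends of the interval `[m,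
  -- (1 + ρ) m]` towards `I` by the fraction `θ`: bound the kernel below by `l` on the nonnegative
  -- functions `b - m b'` and `(1 + ρ) m b' - b`, and the image of `b'` above by `u J`.
  set I := (∫ y, b y ∂ν) / J with hI
  have hIJ : ∫ y, b y ∂ν = I * J := by rw [hI]; field_simp
  set θ := l / u with hθ
  have hθ0 : 0 < θ := by positivity
  have hθ1 : θ ≤ 1 := (div_le_one hu).2 hlu
  have hmI : m ≤ I := by
    rw [hI, le_div_iff₀ hJ0, hJ, ← integral_const_mul]
    exact integral_mono ((hb'.integrable ν).const_mul _) (hb.integrable ν) fun y => (h y).1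
  have hIM : I ≤ (1 + ρ) * m := by
    rw [hI, div_le_iff₀ hJ0, hJ, ← integral_const_mul]
    exact integral_mono (hb.integrable ν) ((hb'.integrable ν).const_mul _) fun y => (h y).2
  have hA (x : X) : θ * SchrodingerBridge.kernelOp ν k b' x ≤ l * J := by
    calc θ * SchrodingerBridge.kernelOp ν k b' x ≤ θ * (u * J) :=
          mul_le_mul_of_nonneg_left ((IsPosBdd.kernelOp ν hk hb').upper x) hθ0.le
      _ = l * J := by rw [hθ]; field_simp
  have i1 (x : X) := (hk.kernel_mul hb x).integrable ν
  have i2 (x : X) := (hk.kernel_mul hb' x).integrable ν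
  have j1 := hb.integrable ν
  have j2 := hb'.integrable ν
  have hlow (x : X) : l * (I - m) * J
      ≤ SchrodingerBridge.kernelOp ν k b x - m * SchrodingerBridge.kernelOp ν k b' x := by
    have e1 : l * (I - m) * J = ∫ y, l * (b y - m * b' y) ∂ν := by
      rw [integral_const_mul, integral_sub j1 (j2.const_mul m), integral_const_mul, hIJ]; ring
    have e2 : SchrodingerBridge.kernelOp ν k b x - m * SchrodingerBridge.kernelOp ν k b' x
        = ∫ y, (k x y * b y - m * (k x y * b' y)) ∂ν := by
      rw [integral_sub (i1 x) ((i2 x).const_mul m), integral_const_mul]; rfl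
    rw [e1, e2]
    refine integral_mono ((j1.sub (j2.const_mul m)).const_mul l)
      ((i1 x).sub ((i2 x).const_mul m)) fun y => ?_
    have : l * (b y - m * b' y) ≤ k x y * (b y - m * b' y) :=
      mul_le_mul_of_nonneg_right (hk.lower (x, y)) (sub_nonneg.2 (h y).1)
    simp only
    linarith
  have hupp (x : X) : l * ((1 + ρ) * m - I) * J
      ≤ (1 + ρ) * m * SchrodingerBridge.kernelOp ν k b' x - SchrodingerBridge.kernelOp ν k b x := by
    have e1 : l * ((1 + ρ) * m - I) * J = ∫ y, l * ((1 + ρ) * m * b' y - b y) ∂ν := by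
      rw [integral_const_mul, integral_sub (j2.const_mul _) j1, integral_const_mul, hIJ]; ring
    have e2 : (1 + ρ) * m * SchrodingerBridge.kernelOp ν k b' x - SchrodingerBridge.kernelOp ν k b x
        = ∫ y, ((1 + ρ) * m * (k x y * b' y) - k x y * b y) ∂ν := by
      rw [integral_sub ((i2 x).const_mul _) (i1 x), integral_const_mul]; rfl
    rw [e1, e2]
    refine integral_mono (((j2.const_mul _).sub j1).const_mul l)
      (((i2 x).const_mul _).sub (i1 x)) fun y => ?_
    have : l * ((1 + ρ) * m * b' y - b y) ≤ k x y * ((1 + ρ) * m * b' y - b y) :=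
      mul_le_mul_of_nonneg_right (hk.lower (x, y)) (sub_nonneg.2 (h y).2)
    simp only
    linarith
  have hm1 : m ≤ m + θ * (I - m) := by
    have := mul_nonneg hθ0.le (sub_nonneg.2 hmI); linarith
  refine ⟨m + θ * (I - m), by linarith, fun x => ⟨?_, ?_⟩⟩
  · have := mul_le_mul_of_nonneg_left (hA x) (sub_nonneg.2 hmI)
    have := hlow x
    linarith
  · have h1 := mul_le_mul_of_nonneg_left (hA x) (sub_nonneg.2 hIM)
    have h2 := hupp x
    have h3 : SchrodingerBridge.kernelOp ν k b x
        ≤ ((1 + ρ) * m - θ * ((1 + ρ) * m - I)) * SchrodingerBridge.kernelOp ν k b' x := by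
      -- The new interval has length `(1 - θ) ρ m`. Its lower end is at least `m`, so the relative
      -- width is at most `(1 - θ) ρ`.
      linarith
    refine h3.trans (mul_le_mul_of_nonneg_right ?_ ((IsPosBdd.kernelOp ν hk hb').pos x).le)
    have h4 : (1 - θ) * ρ * m ≤ (1 - θ) * ρ * (m + θ * (I - m)) :=
      mul_le_mul_of_nonneg_left hm1 (mul_nonneg (by linarith) hρ)
    linarith

end Potentials

/-! ### Sinkhorn iteration and the Schrödinger system. -/

section System

variable {X Y : Type*} [MeasurableSpace X] [MeasurableSpace Y]
  {l u c C : ℝ} {k : X → Y → ℝ} {b b' : Y → ℝ}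

/-- One full Sinkhorn iteration. -/
def sinkhornStep (μ : Measure X) (ν : Measure Y) (k : X → Y → ℝ) (b : Y → ℝ) (y : Y) : ℝ :=
  (kernelOp μ (fun y x => k x y) (fun x => (kernelOp ν k b x)⁻¹) y)⁻¹

/-- Sinkhorn iteration normalized to have value `1` at the base point `y₀`. -/
def normStep (μ : Measure X) (ν : Measure Y) (k : X → Y → ℝ) (y₀ : Y) (b : Y → ℝ) (y : Y) : ℝ :=
  (sinkhornStep μ ν k b y₀)⁻¹ * sinkhornStep μ ν k b y

variable (μ : Measure X) (ν : Measure Y) [IsProbabilityMeasure μ] [IsProbabilityMeasure ν]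

lemma exists_isPosBdd_sinkhornStep [Nonempty X] [Nonempty Y]
    (hk : IsPosBdd l u (Function.uncurry k)) (hb : IsPosBdd c C b) :
    ∃ J, 0 < J ∧ IsPosBdd (u * J)⁻¹ (l * J)⁻¹ (sinkhornStep μ ν k b) :=
  have h1 := (IsPosBdd.kernelOp ν hk hb).inv
  ⟨_, h1.integral_pos μ, (IsPosBdd.kernelOp μ hk.swap h1).inv⟩

/-- A Sinkhorn step takes values in `[1 / (u J), 1 / (l J)]` for some `J`, and `J` cancels on
dividing by the value at `y₀`. The bounds do not involve those of `b`, so they hold uniformly along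
the iteration. -/
lemma isPosBdd_normStep [Nonempty X] (hk : IsPosBdd l u (Function.uncurry k))
    (hb : IsPosBdd c C b) (y₀ : Y) : IsPosBdd (l / u) (u / l) (normStep μ ν k y₀ b) := by
  have : Nonempty Y := ⟨y₀⟩
  obtain ⟨J, hJ, h⟩ := exists_isPosBdd_sinkhornStep μ ν hk hb
  have hl := hk.lower_pos
  have hu := hk.upper_pos
  have h0 := h.pos y₀
  refine ⟨(h.const_mul (inv_pos.2 h0)).measurable, by positivity, fun y => ?_, fun y => ?_⟩
  · calc l / u = ((l * J)⁻¹)⁻¹ * (u * J)⁻¹ := by field_simp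
      _ ≤ _ := mul_le_mul (inv_anti₀ h0 (h.upper y₀)) (h.lower y) h.lower_pos.le
        (inv_pos.2 h0).le
  · calc _ ≤ ((u * J)⁻¹)⁻¹ * (l * J)⁻¹ :=
          mul_le_mul (inv_anti₀ h.lower_pos (h.lower y₀)) (h.upper y) (h.pos y).le
            (by positivity)
      _ = u / l := by field_simp

/-- A step applies two integral operators, each contributing a factor `1 - l / u`; inversion and
rescaling leave the relative width of a ratio interval unchanged. -/
lemma RatioBound.normStep [Nonempty X] {c' C' ρ : ℝ} (hk : IsPosBdd l u (Function.uncurry k))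
    (hlu : l ≤ u) (hb : IsPosBdd c C b) (hb' : IsPosBdd c' C' b') (hρ : 0 ≤ ρ)
    (h : RatioBound ρ b b') (y₀ : Y) :
    RatioBound ((1 - l / u) ^ 2 * ρ) (normStep μ ν k y₀ b) (normStep μ ν k y₀ b') := by
  have : Nonempty Y := ⟨y₀⟩
  have hθ : 0 ≤ 1 - l / u := sub_nonneg.2 ((div_le_one (hk.lower_pos.trans_le hlu)).2 hlu)
  have p1 := IsPosBdd.kernelOp ν hk hb
  have p2 := IsPosBdd.kernelOp ν hk hb'
  have h1 := (h.kernelOp ν hk hlu hb hb' hρ).inv (by positivity) p1.pos p2.pos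
  have q1 := IsPosBdd.kernelOp μ hk.swap p1.inv
  have q2 := IsPosBdd.kernelOp μ hk.swap p2.inv
  have h2 := (h1.kernelOp μ hk.swap hlu p1.inv p2.inv (by positivity)).inv
    (by positivity) q1.pos q2.pos
  have h3 := h2.const_mul (inv_pos.2 (q1.inv.pos y₀)) (inv_pos.2 (q2.inv.pos y₀))
  rw [show (1 - l / u) ^ 2 * ρ = (1 - l / u) * ((1 - l / u) * ρ) by ring]
  exact h3

lemma tendsto_kernelOp {f : ℕ → Y → ℝ} {g : Y → ℝ} (hk : IsPosBdd l u (Function.uncurry k))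
    (hf : ∀ n, IsPosBdd c C (f n)) (h : ∀ y, Tendsto (fun n => f n y) atTop (𝓝 (g y))) (x : X) :
    Tendsto (fun n => kernelOp ν k (f n) x) atTop (𝓝 (kernelOp ν k g x)) :=
  tendsto_integral_of_dominated_convergence (fun _ => u * C)
    (fun n => (hk.kernel_mul (hf n) x).measurable.aestronglyMeasurable) (integrable_const _)
    (fun n => ae_of_all _ (hk.kernel_mul (hf n) x).abs_le)
    (ae_of_all _ fun y => (h y).const_mul _)

/-- The normalized Sinkhorn iteration has a fixed point. -/
lemma exists_normStep_eq [Nonempty X] [Nonempty Y] (hk : IsPosBdd l u (Function.uncurry k)) :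
    ∃ (y₀ : Y) (b : Y → ℝ), IsPosBdd (l / u) (u / l) b ∧ normStep μ ν k y₀ b = b := by
  obtain ⟨y₀⟩ := ‹Nonempty Y›
  have : Nonempty Y := ⟨y₀⟩
  have hl := hk.lower_pos
  have hu := hk.upper_pos
  have hlu : l ≤ u := (hk.lower (Classical.arbitrary _)).trans (hk.upper _)
  have hθ : 0 ≤ 1 - l / u := sub_nonneg.2 ((div_le_one hu).2 hlu)
  have hul : 1 ≤ u / l := (one_le_div hl).2 hlu
  let β : ℕ → Y → ℝ := fun n => (normStep μ ν k y₀)^[n] fun _ => 1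
  have hβs (n : ℕ) : β (n + 1) = normStep μ ν k y₀ (β n) :=
    Function.iterate_succ_apply' (normStep μ ν k y₀) n _
  have hβ (n : ℕ) : IsPosBdd (l / u) (u / l) (β n) := by
    induction n with
    | zero => exact ⟨measurable_const, by positivity, fun _ => (div_le_one hu).2 hlu, fun _ => hul⟩
    | succ n ih => rw [hβs]; exact isPosBdd_normStep μ ν hk ih y₀
  have hβ0 (n : ℕ) : β n y₀ = 1 := by
    cases n with
    | zero => rfl
    | succ n =>
      rw [hβs]
      obtain ⟨J, hJ, h⟩ := exists_isPosBdd_sinkhornStep μ ν hk (hβ n)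
      exact inv_mul_cancel₀ (h.pos y₀).ne'
  -- The first ratio `β 1 / β 0 = β 1` lies in `[l / u, u / l]`, whose ends have quotient `1 + ρ₀`.
  set ρ₀ := (u / l) ^ 2 - 1 with hρ₀
  have hρ0 : 0 ≤ ρ₀ := by nlinarith
  set q := (1 - l / u) ^ 2 with hq
  have hq1 : q < 1 := by
    have : 0 < l / u := by positivity
    rw [hq]; nlinarith
  have hratio (n : ℕ) : RatioBound (q ^ n * ρ₀) (β (n + 1)) (β n) := by
    induction n with
    | zero =>
      refine ⟨l / u, by positivity, fun y => ?_⟩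
      have e : β 0 y = 1 := rfl
      rw [e, mul_one, mul_one]
      refine ⟨(hβ 1).lower y, ((hβ 1).upper y).trans_eq ?_⟩
      rw [hρ₀]; field_simp; ring
    | succ n ih =>
      have := ih.normStep μ ν hk hlu (hβ _) (hβ _) (by positivity) y₀
      rw [← hβs, ← hβs] at this
      rwa [pow_succ', mul_assoc]
  -- Successive iterates agree at `y₀`, so their nearly constant ratio is nearly `1`.
  have hcauchy (y : Y) : CauchySeq fun n => β n y := by
    refine cauchySeq_of_le_geometric q (ρ₀ * (u / l)) hq1 fun n => ?_
    rw [dist_comm, Real.dist_eq]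
    calc _ ≤ q ^ n * ρ₀ * β n y :=
          (hratio n).abs_sub_le (by positivity) (hβ n).pos (hβ0 _) (hβ0 _) y
      _ ≤ q ^ n * ρ₀ * (u / l) := mul_le_mul_of_nonneg_left ((hβ n).upper y) (by positivity)
      _ = _ := by ring
  choose b hb using fun y => cauchySeq_tendsto_of_complete (hcauchy y)
  have hbb : IsPosBdd (l / u) (u / l) b :=
    ⟨measurable_of_tendsto_metrizable (fun n => (hβ n).measurable) (tendsto_pi_nhds.2 hb),
      by positivity, fun y => ge_of_tendsto' (hb y) fun n => (hβ n).lower y,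
      fun y => le_of_tendsto' (hb y) fun n => (hβ n).upper y⟩
  refine ⟨y₀, b, hbb, ?_⟩
  have p1 := IsPosBdd.kernelOp ν hk hbb
  have hlim1 (x : X) : Tendsto (fun n => (kernelOp ν k (β n) x)⁻¹) atTop
      (𝓝 (kernelOp ν k b x)⁻¹) :=
    (tendsto_kernelOp ν hk hβ hb x).inv₀ (p1.pos x).ne'
  -- Dominated convergence needs bounds independent of `n`, so the mass of `β n` is replaced by its
  -- extreme values.
  have hbd (n : ℕ) : IsPosBdd (u * (u / l))⁻¹ (l * (l / u))⁻¹
      (fun x => (kernelOp ν k (β n) x)⁻¹) := by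
    have p := IsPosBdd.kernelOp ν hk (hβ n)
    have : IsPosBdd (l * (l / u)) (u * (u / l)) (kernelOp ν k (β n)) :=
      ⟨p.measurable, by positivity,
        fun x => (mul_le_mul_of_nonneg_left ((hβ n).le_integral ν) hl.le).trans (p.lower x),
        fun x => (p.upper x).trans (mul_le_mul_of_nonneg_left ((hβ n).integral_le ν) hu.le)⟩
    exact this.inv
  have p2 := IsPosBdd.kernelOp μ hk.swap p1.inv
  have hlim2 (y : Y) : Tendsto (fun n => sinkhornStep μ ν k (β n) y) atTop
      (𝓝 (sinkhornStep μ ν k b y)) :=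
    (tendsto_kernelOp μ hk.swap hbd hlim1 y).inv₀ (p2.pos y).ne'
  ext y
  have hlim3 : Tendsto (fun n => normStep μ ν k y₀ (β n) y) atTop
      (𝓝 (normStep μ ν k y₀ b y)) :=
    ((hlim2 y₀).inv₀ (inv_pos.2 (p2.pos y₀)).ne').mul (hlim2 y)
  refine tendsto_nhds_unique hlim3 ?_
  simp_rw [← hβs]
  exact (hb y).comp (tendsto_add_atTop_nat 1)

/-- The Schrödinger system with a kernel bounded above and below has a bounded solution. -/
theorem exists_schrodinger_system (hk : IsPosBdd l u (Function.uncurry k)) :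
    ∃ (a : X → ℝ) (b : Y → ℝ), IsPosBdd u⁻¹ l⁻¹ a ∧ IsPosBdd (l / u) (u / l) b ∧
      (∀ x, a x * ∫ y, k x y * b y ∂ν = 1) ∧ (∀ y, b y * ∫ x, k x y * a x ∂μ = 1) ∧
      ∀ x y, a x * b y ≤ u / l ^ 2 := by
  have : Nonempty X := nonempty_of_isProbabilityMeasure μ
  have : Nonempty Y := nonempty_of_isProbabilityMeasure ν
  have hl := hk.lower_pos
  have hu := hk.upper_pos
  obtain ⟨y₀, b₁, hb₁, hfix⟩ := exists_normStep_eq μ ν hk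
  -- A Sinkhorn step is homogeneous of degree one, so the fixed point can be rescaled to unit mass
  -- while remaining an eigenfunction, with eigenvalue `s⁻¹`.
  obtain ⟨c, C, b, hb, hbI, s, hs, hbs⟩ : ∃ (c C : ℝ) (b : Y → ℝ), IsPosBdd c C b ∧
      ∫ y, b y ∂ν = 1 ∧ ∃ s, 0 < s ∧ ∀ y, b y = s * sinkhornStep μ ν k b y := by
    have hI := hb₁.integral_pos ν
    set I := ∫ y, b₁ y ∂ν
    obtain ⟨J, hJ, h⟩ := exists_isPosBdd_sinkhornStep μ ν hk hb₁
    refine ⟨_, _, _, hb₁.const_mul (inv_pos.2 hI), ?_, (sinkhornStep μ ν k b₁ y₀)⁻¹,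
      inv_pos.2 (h.pos y₀), fun y => ?_⟩
    · rw [integral_const_mul]; exact inv_mul_cancel₀ hI.ne'
    · have e1 (x : X) : (kernelOp ν k (fun y => I⁻¹ * b₁ y) x)⁻¹
          = I * (kernelOp ν k b₁ x)⁻¹ := by
        simp only [kernelOp, mul_left_comm _ I⁻¹, integral_const_mul, mul_inv, inv_inv]
      have e2 : sinkhornStep μ ν k (fun y => I⁻¹ * b₁ y) y = I⁻¹ * sinkhornStep μ ν k b₁ y := by
        simp only [sinkhornStep, e1]
        simp only [kernelOp, mul_left_comm _ I, integral_const_mul, mul_inv]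
      rw [e2, mul_left_comm]
      congr 1
      exact (congrFun hfix y).symm
  have p1 := IsPosBdd.kernelOp ν hk hb
  set a : X → ℝ := fun x => (kernelOp ν k b x)⁻¹ with ha_def
  have ha : IsPosBdd u⁻¹ l⁻¹ a := by
    have := p1.inv
    rwa [hbI, mul_one, mul_one] at this
  have hsys1 (x : X) : a x * ∫ y, k x y * b y ∂ν = 1 := inv_mul_cancel₀ (p1.pos x).ne'
  have p2 := IsPosBdd.kernelOp μ hk.swap ha
  have hsys2 (y : Y) : b y * ∫ x, k x y * a x ∂μ = s := by
    have : b y = s * (kernelOp μ (fun y x => k x y) a y)⁻¹ := hbs y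
    rw [this, mul_assoc]
    have h3 : (kernelOp μ (fun y x => k x y) a y)⁻¹ * ∫ x, k x y * a x ∂μ = 1 :=
      inv_mul_cancel₀ (p2.pos y).ne'
    rw [h3, mul_one]
  -- Integrating `a k b` over both variables gives `1` in one order and `s` in the other.
  have hs1 : s = 1 := by
    have hint : Integrable (Function.uncurry fun x y => a x * (k x y * b y)) (μ.prod ν) :=
      ((ha.comp measurable_fst).mul (hk.mul (hb.comp measurable_snd))).integrable _
    have e1 : ∫ x, ∫ y, a x * (k x y * b y) ∂ν ∂μ = 1 := by
      simp only [integral_const_mul, hsys1, integral_const, probReal_univ, smul_eq_mul, mul_one]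
    have e2 : ∫ y, ∫ x, a x * (k x y * b y) ∂μ ∂ν = s := by
      have (y : Y) : ∫ x, a x * (k x y * b y) ∂μ = s := by
        rw [← hsys2 y, ← integral_const_mul]
        exact integral_congr_ae (ae_of_all _ fun x => by ring)
      simp only [this, integral_const, probReal_univ, smul_eq_mul, one_mul]
    rw [← e1, ← e2, integral_integral_swap hint]
  subst hs1
  -- The bounds `1 / u ≤ J ≤ 1 / l` turn `1 / (u J) ≤ b ≤ 1 / (l J)` into bounds in `l` and `u`
  -- alone.
  set J := ∫ x, a x ∂μ with hJ
  have hJ1 : u⁻¹ ≤ J := ha.le_integral μ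
  have hJ2 : J ≤ l⁻¹ := ha.integral_le μ
  have hJ0 : 0 < J := ha.integral_pos μ
  have hbe (y : Y) : b y = (kernelOp μ (fun y x => k x y) a y)⁻¹ :=
    eq_inv_of_mul_eq_one_left (hsys2 y)
  have p3 := p2.inv
  have hup : (l * J)⁻¹ ≤ u / l := by
    calc (l * J)⁻¹ ≤ (l * u⁻¹)⁻¹ := inv_anti₀ (by positivity) (by gcongr)
      _ = u / l := by field_simp
  refine ⟨a, b, ha, ⟨hb.measurable, by positivity, fun y => ?_, fun y => ?_⟩, hsys1, hsys2,
    fun x y => ?_⟩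
  · rw [hbe]
    refine le_trans ?_ (p3.lower y)
    calc l / u = (u * l⁻¹)⁻¹ := by field_simp
      _ ≤ _ := inv_anti₀ (by positivity) (by gcongr)
  · rw [hbe]; exact (p3.upper y).trans hup
  · have hby : b y ≤ u / l := by rw [hbe]; exact (p3.upper y).trans hup
    calc a x * b y ≤ l⁻¹ * (u / l) :=
          mul_le_mul (ha.upper x) hby (hb.pos y).le (by positivity)
      _ = u / l ^ 2 := by field_simp

end System

/-! ### Product-form couplings are the unique entropy minimizers. -/

section Bridge

variable {X Y : Type*} [MeasurableSpace X] [MeasurableSpace Y]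

lemma IsPosBdd.measurable_log {α : Type*} [MeasurableSpace α] {l u : ℝ} {f : α → ℝ}
    (hf : IsPosBdd l u f) : Measurable fun x => Real.log (f x) :=
  Real.measurable_log.comp hf.measurable

lemma IsPosBdd.integrable_log {α : Type*} [MeasurableSpace α] {l u : ℝ} {f : α → ℝ}
    (hf : IsPosBdd l u f) (μ : Measure α) [IsFiniteMeasure μ] :
    Integrable (fun x => Real.log (f x)) μ := by
  refine Integrable.of_bound hf.measurable_log.aestronglyMeasurable
    (|Real.log l| + |Real.log u|) (ae_of_all _ fun x => ?_)
  have h1 := Real.log_le_log hf.lower_pos (hf.lower x)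
  have h2 := Real.log_le_log (hf.pos x) (hf.upper x)
  rw [Real.norm_eq_abs, _root_.abs_le]
  constructor
  · linarith [neg_abs_le (Real.log l), abs_nonneg (Real.log u)]
  · linarith [le_abs_self (Real.log u), abs_nonneg (Real.log l)]

lemma IsCoupling.isProbabilityMeasure {μ₀ : Measure X} {μ₁ : Measure Y} {H : Measure (X × Y)}
    [IsProbabilityMeasure μ₀] (h : IsCoupling μ₀ μ₁ H) : IsProbabilityMeasure H := by
  refine ⟨?_⟩
  have := congrArg (fun m => m Set.univ) h.1
  simpa [Measure.map_apply measurable_fst MeasurableSet.univ] using this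

lemma IsCoupling.integral_fst {μ₀ : Measure X} {μ₁ : Measure Y} {H : Measure (X × Y)}
    (h : IsCoupling μ₀ μ₁ H) {f : X → ℝ} (hf : Measurable f) :
    ∫ p, f p.1 ∂H = ∫ x, f x ∂μ₀ := by
  rw [← h.1, integral_map measurable_fst.aemeasurable hf.aestronglyMeasurable]

lemma IsCoupling.integral_snd {μ₀ : Measure X} {μ₁ : Measure Y} {H : Measure (X × Y)}
    (h : IsCoupling μ₀ μ₁ H) {f : Y → ℝ} (hf : Measurable f) :
    ∫ p, f p.2 ∂H = ∫ x, f x ∂μ₁ := by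
  rw [← h.2, integral_map measurable_snd.aemeasurable hf.aestronglyMeasurable]

lemma IsCoupling.integrable_fst {μ₀ : Measure X} {μ₁ : Measure Y} {H : Measure (X × Y)}
    (h : IsCoupling μ₀ μ₁ H) {f : X → ℝ} (hf : Integrable f μ₀) :
    Integrable (fun p => f p.1) H := by
  rw [← h.1] at hf
  exact hf.comp_measurable measurable_fst

lemma IsCoupling.integrable_snd {μ₀ : Measure X} {μ₁ : Measure Y} {H : Measure (X × Y)}
    (h : IsCoupling μ₀ μ₁ H) {f : Y → ℝ} (hf : Integrable f μ₁) :
    Integrable (fun p => f p.2) H := by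
  rw [← h.2] at hf
  exact hf.comp_measurable measurable_snd

/-- The measure `a ⊗ b · R`. -/
def scaledMeasure (R : Measure (X × Y)) (a : X → ℝ) (b : Y → ℝ) : Measure (X × Y) :=
  R.withDensity fun p => ENNReal.ofReal (a p.1 * b p.2)

variable {μ₀ : Measure X} {μ₁ : Measure Y} {R H : Measure (X × Y)} {a : X → ℝ} {b : Y → ℝ}
  {l u l' u' : ℝ}

lemma measurable_scaling (ha : IsPosBdd l u a) (hb : IsPosBdd l' u' b) :
    Measurable fun p : X × Y => ENNReal.ofReal (a p.1 * b p.2) :=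
  ((ha.measurable.comp measurable_fst).mul (hb.measurable.comp measurable_snd)).ennreal_ofReal

lemma ofReal_scaling_ne_zero (ha : IsPosBdd l u a) (hb : IsPosBdd l' u' b) (p : X × Y) :
    ENNReal.ofReal (a p.1 * b p.2) ≠ 0 :=
  (ENNReal.ofReal_pos.2 (mul_pos (ha.pos _) (hb.pos _))).ne'

/-- Chain rule: dividing `dH/dR` by the density `a ⊗ b` gives the density of `H` relative to the
scaled measure. -/
lemma llr_ae_eq_llr_scaledMeasure [IsFiniteMeasure R] [IsFiniteMeasure H]
    (ha : IsPosBdd l u a) (hb : IsPosBdd l' u' b) (hHR : H ≪ R) :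
    llr H R =ᵐ[H] fun p => llr H (scaledMeasure R a b) p
      + (Real.log (a p.1) + Real.log (b p.2)) := by
  have h1 := hHR.ae_le (Measure.rnDeriv_withDensity_right H R
    (measurable_scaling ha hb).aemeasurable (ae_of_all _ (ofReal_scaling_ne_zero ha hb))
    (ae_of_all _ fun _ => ENNReal.ofReal_ne_top))
  filter_upwards [h1, Measure.rnDeriv_pos hHR, hHR.ae_le (Measure.rnDeriv_lt_top H R)]
    with p hp hpos hlt
  have h2 := ENNReal.toReal_pos hpos.ne' hlt.ne
  have ha' := ha.pos p.1
  have hb' := hb.pos p.2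
  rw [llr, llr, scaledMeasure, hp, ENNReal.toReal_mul, ENNReal.toReal_inv,
    ENNReal.toReal_ofReal (by positivity), Real.log_mul (by positivity) h2.ne', Real.log_inv,
    Real.log_mul ha'.ne' hb'.ne']
  ring

lemma absolutelyContinuous_scaledMeasure (ha : IsPosBdd l u a) (hb : IsPosBdd l' u' b) :
    R ≪ scaledMeasure R a b :=
  withDensity_absolutelyContinuous' (measurable_scaling ha hb).aemeasurable
    (ae_of_all _ (ofReal_scaling_ne_zero ha hb))

/-- A coupling of the form `a ⊗ b · R` is the unique bridge with reference measure `R`. -/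
theorem isBridge_scaledMeasure [IsProbabilityMeasure μ₀] [IsProbabilityMeasure μ₁]
    [IsFiniteMeasure R] (ha : IsPosBdd l u a) (hb : IsPosBdd l' u' b)
    (hπ : IsCoupling μ₀ μ₁ (scaledMeasure R a b)) :
    IsBridge μ₀ μ₁ R (scaledMeasure R a b) ∧
      ∀ π', IsBridge μ₀ μ₁ R π' → π' = scaledMeasure R a b := by
  set π := scaledMeasure R a b with hπ_def
  have : IsProbabilityMeasure π := hπ.isProbabilityMeasure
  have hRπ : R ≪ π := absolutelyContinuous_scaledMeasure ha hb
  have hπR : π ≪ R := withDensity_absolutelyContinuous _ _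
  set D := ∫ x, Real.log (a x) ∂μ₀ + ∫ y, Real.log (b y) ∂μ₁ with hD
  have hint (H : Measure (X × Y)) (hH : IsCoupling μ₀ μ₁ H) :
      Integrable (fun p => Real.log (a p.1) + Real.log (b p.2)) H :=
    (hH.integrable_fst (ha.integrable_log μ₀)).add (hH.integrable_snd (hb.integrable_log μ₁))
  have hDH (H : Measure (X × Y)) (hH : IsCoupling μ₀ μ₁ H) :
      ∫ p, (Real.log (a p.1) + Real.log (b p.2)) ∂H = D := by
    rw [integral_add (hH.integrable_fst (ha.integrable_log μ₀))
      (hH.integrable_snd (hb.integrable_log μ₁)), hH.integral_fst ha.measurable_log,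
      hH.integral_snd hb.measurable_log]
  -- Pythagorean identity: on couplings, the divergence from `R` is the divergence from `π` plus a
  -- constant, and the former summand vanishes only at `π`.
  have key (H : Measure (X × Y)) (hH : IsCoupling μ₀ μ₁ H) (hHR : H ≪ R)
      (hi : Integrable (llr H R) H) :
      0 ≤ ∫ p, llr H π p ∂H ∧ (∫ p, llr H π p ∂H ≤ 0 → H = π) ∧
        InformationTheory.klDiv H R =
          ENNReal.ofReal (∫ p, llr H π p ∂H + (D + R.real Set.univ - 1)) := by
    have : IsProbabilityMeasure H := hH.isProbabilityMeasure
    have hae := llr_ae_eq_llr_scaledMeasure ha hb hHR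
    rw [← hπ_def] at hae
    have hHπ : H ≪ π := hHR.trans hRπ
    have hi2 : Integrable (llr H π) H := by
      refine (hi.sub (hint H hH)).congr ?_
      filter_upwards [hae] with p hp
      simp only [Pi.sub_apply, hp]; ring
    have hnn := InformationTheory.integral_llr_add_sub_measure_univ_nonneg hHπ hi2
    simp only [probReal_univ, add_sub_cancel_right] at hnn
    refine ⟨hnn, fun hle => ?_, ?_⟩
    · rw [← InformationTheory.klDiv_eq_zero_iff,
        InformationTheory.klDiv_of_ac_of_integrable hHπ hi2]
      simpa using hle
    · rw [InformationTheory.klDiv_of_ac_of_integrable hHR hi, integral_congr_ae hae,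
        integral_add hi2 (hint H hH), hDH H hH, probReal_univ (μ := H)]
      congr 1; ring
  have hiπ : Integrable (llr π R) π := by
    refine (hint π hπ).congr ?_
    have h1 := hπR.ae_le (Measure.rnDeriv_withDensity R (measurable_scaling ha hb))
    filter_upwards [h1] with p hp
    have ha' := ha.pos p.1
    have hb' := hb.pos p.2
    rw [llr, hπ_def, scaledMeasure, hp, ENNReal.toReal_ofReal (by positivity),
      Real.log_mul ha'.ne' hb'.ne']
  have hππ : ∫ p, llr π π p ∂π = 0 := by
    rw [integral_congr_ae (llr_self π)]; simp
  obtain ⟨-, -, hklπ⟩ := key π hπ hπR hiπ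
  rw [hππ, zero_add] at hklπ
  have hgibbs := InformationTheory.integral_llr_add_sub_measure_univ_nonneg hπR hiπ
  -- `ENNReal.ofReal` truncates negative numbers, so comparing values needs this sign. It is Gibbs'
  -- inequality for `π` relative to `R`.
  have hDnn : 0 ≤ D + R.real Set.univ - 1 := by
    have h := llr_ae_eq_llr_scaledMeasure ha hb hπR
    rw [← hπ_def] at h
    have hz : llr π R =ᵐ[π] fun p => Real.log (a p.1) + Real.log (b p.2) := by
      filter_upwards [h, llr_self π] with p hp hp'
      rw [hp, hp']; simp
    rwa [integral_congr_ae hz, hDH π hπ, probReal_univ (μ := π)] at hgibbs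
  refine ⟨⟨hπ, fun H hH => ?_⟩, fun π' hπ' => ?_⟩
  · by_cases htop : InformationTheory.klDiv H R = ⊤
    · rw [htop]; exact le_top
    · obtain ⟨h1, h2⟩ := InformationTheory.klDiv_ne_top_iff.1 htop
      obtain ⟨hnn, -, hkl⟩ := key H hH h1 h2
      rw [hklπ, hkl]
      exact ENNReal.ofReal_le_ofReal (by linarith)
  · have hle := hπ'.2 π hπ
    have htop : InformationTheory.klDiv π' R ≠ ⊤ := by
      refine ne_top_of_le_ne_top ?_ hle
      rw [hklπ]; exact ENNReal.ofReal_ne_top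
    obtain ⟨h1, h2⟩ := InformationTheory.klDiv_ne_top_iff.1 htop
    obtain ⟨hnn, heq, hkl⟩ := key π' hπ'.1 h1 h2
    rw [hkl, hklπ, ENNReal.ofReal_le_ofReal_iff hDnn] at hle
    exact heq (by linarith)

end Bridge

/-! ### Measures given by densities, and the bounded-ratio condition. -/

section Density

variable {X Y : Type*} [MeasureSpace X] [MeasureSpace Y]

lemma IsProbDensity.isProbabilityMeasure {f : X → ℝ} (hf : IsProbDensity f) :
    IsProbabilityMeasure (densityMeasure f) := by
  refine ⟨?_⟩
  rw [densityMeasure, withDensity_apply _ MeasurableSet.univ, Measure.restrict_univ,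
    ← ofReal_integral_eq_lintegral_ofReal hf.integrable hf.nonneg, hf.integral_eq_one,
    ENNReal.ofReal_one]

lemma isFiniteMeasure_densityMeasure {f : X → ℝ} (hf : Integrable f) :
    IsFiniteMeasure (densityMeasure f) :=
  isFiniteMeasure_withDensity_ofReal hf.2

lemma integral_densityMeasure {f : X → ℝ} (hf : AEMeasurable f) (h0 : ∀ᵐ x, 0 ≤ f x)
    (g : X → ℝ) : ∫ x, g x ∂(densityMeasure f) = ∫ x, f x * g x := by
  rw [densityMeasure, integral_withDensity_eq_integral_toReal_smul₀ hf.ennreal_ofReal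
    (ae_of_all _ fun _ => ENNReal.ofReal_lt_top)]
  refine integral_congr_ae ?_
  filter_upwards [h0] with x hx
  rw [ENNReal.toReal_ofReal hx, smul_eq_mul]

lemma ae_comp_fst {P : X → Prop} (h : ∀ᵐ x, P x) : ∀ᵐ p : X × Y, P p.1 :=
  Measure.quasiMeasurePreserving_fst.ae h

lemma ae_comp_snd {P : Y → Prop} (h : ∀ᵐ y, P y) : ∀ᵐ p : X × Y, P p.2 :=
  Measure.quasiMeasurePreserving_snd.ae h

/-- `ρ₀`, `ρ₁` are positive probability densities, and the density `φ` is comparable to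
`ρ₀ ⊗ ρ₁` up to the factor `exp K`. -/
structure HasBoundedRatio (K : ℝ) (ρ₀ : X → ℝ) (ρ₁ : Y → ℝ) (φ : X × Y → ℝ) : Prop where
  fst : IsProbDensity ρ₀
  snd : IsProbDensity ρ₁
  fst_pos : ∀ᵐ x, 0 < ρ₀ x
  snd_pos : ∀ᵐ y, 0 < ρ₁ y
  integrable : Integrable φ
  lower : ∀ᵐ p : X × Y, Real.exp (-K) * (ρ₀ p.1 * ρ₁ p.2) ≤ φ p
  upper : ∀ᵐ p : X × Y, φ p ≤ Real.exp K * (ρ₀ p.1 * ρ₁ p.2)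

variable {K : ℝ} {ρ₀ : X → ℝ} {ρ₁ : Y → ℝ} {φ : X × Y → ℝ}

lemma HasBoundedRatio.pos (h : HasBoundedRatio K ρ₀ ρ₁ φ) : ∀ᵐ p, 0 < φ p := by
  filter_upwards [h.lower, ae_comp_fst h.fst_pos, ae_comp_snd h.snd_pos] with p hp h0 h1
  exact lt_of_lt_of_le (by positivity) hp

variable [SigmaFinite (volume : Measure Y)]

/-- The kernel is `φ / (ρ₀ ⊗ ρ₁)`, formed from measurable representatives and clamped. Clamping
changes it only on a null set and makes the bounds hold everywhere, as the Sinkhorn argument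
requires. -/
lemma HasBoundedRatio.exists_kernel (h : HasBoundedRatio K ρ₀ ρ₁ φ) :
    ∃ k : X → Y → ℝ, IsPosBdd (min (Real.exp (-K)) (Real.exp K)) (max (Real.exp (-K)) (Real.exp K))
        (Function.uncurry k) ∧
      densityMeasure φ = ((densityMeasure ρ₀).prod (densityMeasure ρ₁)).withDensity
        fun p => ENNReal.ofReal (k p.1 p.2) := by
  have m0 := h.fst.integrable.1
  have m1 := h.snd.integrable.1
  obtain ⟨ρ₀', s0, a0⟩ := h.fst.integrable.1
  obtain ⟨ρ₁', s1, a1⟩ := h.snd.integrable.1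
  obtain ⟨φ', s2, a2⟩ := h.integrable.1
  have hmk : Measurable fun p : X × Y => max (Real.exp (-K)) (min (Real.exp K)
      (φ' (p.1, p.2) / (ρ₀' p.1 * ρ₁' p.2))) :=
    measurable_const.max (measurable_const.min (s2.measurable.div
      ((s0.measurable.comp measurable_fst).mul (s1.measurable.comp measurable_snd))))
  refine ⟨fun x y => max (Real.exp (-K)) (min (Real.exp K) (φ' (x, y) / (ρ₀' x * ρ₁' y))),
    ⟨hmk, ?_, fun p => ?_, fun p => ?_⟩, ?_⟩
  · exact lt_min (Real.exp_pos _) (Real.exp_pos _)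
  · exact (min_le_left _ _).trans (le_max_left _ _)
  · exact max_le_max le_rfl (min_le_left _ _)
  · have hm := hmk.ennreal_ofReal
    have n0 : AEMeasurable fun x => ENNReal.ofReal (ρ₀ x) := m0.aemeasurable.ennreal_ofReal
    have n1 : AEMeasurable fun x => ENNReal.ofReal (ρ₁ x) := m1.aemeasurable.ennreal_ofReal
    have n2 : AEMeasurable (fun p : X × Y => ENNReal.ofReal (ρ₀ p.1) * ENNReal.ofReal (ρ₁ p.2))
        (volume.prod volume) :=
      (n0.comp_quasiMeasurePreserving Measure.quasiMeasurePreserving_fst).mul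
        (n1.comp_quasiMeasurePreserving Measure.quasiMeasurePreserving_snd)
    rw [densityMeasure, densityMeasure, densityMeasure, prod_withDensity₀ n0 n1,
      ← withDensity_mul₀ n2 hm.aemeasurable, Measure.volume_eq_prod]
    refine withDensity_congr_ae ?_
    rw [← Measure.volume_eq_prod]
    filter_upwards [h.lower, h.upper, ae_comp_fst h.fst_pos, ae_comp_snd h.snd_pos,
      ae_comp_fst a0, ae_comp_snd a1, a2]
      with p hl hu h0 h1 e0 e1 e2
    have e2' : φ' (p.1, p.2) = φ p := e2.symm
    simp only [Pi.mul_apply]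
    rw [← e0, ← e1, e2', min_eq_right, max_eq_right, ← ENNReal.ofReal_mul h0.le,
      ← ENNReal.ofReal_mul (by positivity)]
    · congr 1; field_simp
    · rwa [le_div_iff₀ (by positivity)]
    · rwa [div_le_iff₀ (by positivity)]

end Density

/-! ### From potentials to couplings. -/

section Coupling

variable {X Y : Type*} [MeasurableSpace X] [MeasurableSpace Y]

lemma lintegral_ofReal_eq_one {α : Type*} [MeasurableSpace α] {μ : Measure α} [IsFiniteMeasure μ]
    {l u : ℝ} {f : α → ℝ} (hf : IsPosBdd l u f) (h : ∫ x, f x ∂μ = 1) :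
    ∫⁻ x, ENNReal.ofReal (f x) ∂μ = 1 := by
  rw [← ofReal_integral_eq_lintegral_ofReal (hf.integrable μ) (ae_of_all _ fun x => (hf.pos x).le),
    h, ENNReal.ofReal_one]

/-- Solutions of the Schrödinger system give couplings. -/
lemma isCoupling_of_system {μ : Measure X} {ν : Measure Y} [IsProbabilityMeasure μ]
    [IsProbabilityMeasure ν] {l u l₁ u₁ l₂ u₂ : ℝ} {k : X → Y → ℝ} {a : X → ℝ} {b : Y → ℝ}
    (hk : IsPosBdd l u (Function.uncurry k)) (ha : IsPosBdd l₁ u₁ a) (hb : IsPosBdd l₂ u₂ b)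
    (h1 : ∀ x, a x * ∫ y, k x y * b y ∂ν = 1) (h2 : ∀ y, b y * ∫ x, k x y * a x ∂μ = 1) :
    IsCoupling μ ν
      (scaledMeasure ((μ.prod ν).withDensity fun p => ENNReal.ofReal (k p.1 p.2)) a b) := by
  have hF : IsPosBdd (l * (l₁ * l₂)) (u * (u₁ * u₂))
      fun p : X × Y => k p.1 p.2 * (a p.1 * b p.2) :=
    hk.mul ((ha.comp measurable_fst).mul (hb.comp measurable_snd))
  have hFm := hF.measurable.ennreal_ofReal
  have hS : scaledMeasure ((μ.prod ν).withDensity fun p => ENNReal.ofReal (k p.1 p.2)) a b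
      = (μ.prod ν).withDensity fun p => ENNReal.ofReal (k p.1 p.2 * (a p.1 * b p.2)) := by
    have hkm : Measurable fun p : X × Y => ENNReal.ofReal (k p.1 p.2) :=
      hk.measurable.ennreal_ofReal
    rw [scaledMeasure, ← withDensity_mul _ hkm (measurable_scaling ha hb)]
    congr 1
    ext p
    exact (ENNReal.ofReal_mul (hk.pos p).le).symm
  have i1 (x : X) : ∫⁻ y, ENNReal.ofReal (k x y * (a x * b y)) ∂ν = 1 := by
    refine lintegral_ofReal_eq_one (hF.comp (measurable_prodMk_left (x := x))) ?_
    rw [← h1 x, ← integral_const_mul]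
    exact integral_congr_ae (ae_of_all _ fun y => by ring)
  have i2 (y : Y) : ∫⁻ x, ENNReal.ofReal (k x y * (a x * b y)) ∂μ = 1 := by
    refine lintegral_ofReal_eq_one (hF.comp (measurable_prodMk_right (y := y))) ?_
    rw [← h2 y, ← integral_const_mul]
    exact integral_congr_ae (ae_of_all _ fun y => by ring)
  rw [hS]
  constructor
  · ext s hs
    rw [Measure.map_apply measurable_fst hs, withDensity_apply _ (measurable_fst hs),
      ← Set.prod_univ, ← Measure.prod_restrict, Measure.restrict_univ,
      lintegral_prod _ hFm.aemeasurable]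
    simp [i1]
  · ext s hs
    rw [Measure.map_apply measurable_snd hs, withDensity_apply _ (measurable_snd hs),
      ← Set.univ_prod, ← Measure.prod_restrict, Measure.restrict_univ,
      lintegral_prod_symm _ hFm.aemeasurable]
    simp [i2]

end Coupling

/-! ### Potentials under a bounded ratio. -/

section Density

variable {X Y : Type*} [MeasureSpace X] [MeasureSpace Y]
  [SigmaFinite (volume : Measure Y)] {K : ℝ} {ρ₀ : X → ℝ} {ρ₁ : Y → ℝ} {φ : X × Y → ℝ}

/-- `a ⊗ b · φ` is the density of a coupling, with `a` and `b` bounded in terms of `K`. -/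
structure IsPotentialPair (K : ℝ) (ρ₀ : X → ℝ) (ρ₁ : Y → ℝ) (φ : X × Y → ℝ)
    (a : X → ℝ) (b : Y → ℝ) : Prop where
  fst : IsPosBdd (Real.exp (-K)) (Real.exp K) a
  snd : IsPosBdd (Real.exp (-(2 * K))) (Real.exp (2 * K)) b
  mul_le : ∀ x y, a x * b y ≤ Real.exp (3 * K)
  coupling : IsCoupling (densityMeasure ρ₀) (densityMeasure ρ₁)
    (scaledMeasure (densityMeasure φ) a b)

theorem HasBoundedRatio.exists_isPotentialPair (h : HasBoundedRatio K ρ₀ ρ₁ φ) (hK : 0 ≤ K) :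
    ∃ a b, IsPotentialPair K ρ₀ ρ₁ φ a b := by
  have := h.fst.isProbabilityMeasure
  have := h.snd.isProbabilityMeasure
  obtain ⟨k, hk, he⟩ := h.exists_kernel
  rw [min_eq_left (Real.exp_le_exp.2 (by linarith)),
    max_eq_right (Real.exp_le_exp.2 (by linarith))] at hk
  obtain ⟨a, b, ha, hb, h1, h2, h3⟩ :=
    exists_schrodinger_system (densityMeasure ρ₀) (densityMeasure ρ₁) hk
  rw [← Real.exp_neg, ← Real.exp_neg, neg_neg] at ha
  rw [← Real.exp_sub, ← Real.exp_sub] at hb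
  refine ⟨a, b, ha, ?_, fun x y => (h3 x y).trans_eq ?_, ?_⟩
  · convert hb using 2 <;> ring
  -- With `l = exp (-K)` and `u = exp K`, the bound `u / l ^ 2` is `exp (3K)`.
  · rw [← Real.exp_nat_mul, ← Real.exp_sub]; congr 1; push_cast; ring
  · rw [he]; exact isCoupling_of_system hk ha hb h1 h2

end Density

/-! ### Hellinger distance in terms of Lebesgue densities. -/

section Hellinger

variable {α : Type*} [MeasureSpace α] {f g : α → ℝ}

lemma densityMeasure_congr (h : f =ᵐ[volume] g) : densityMeasure f = densityMeasure g :=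
  withDensity_congr_ae (h.mono fun x hx => by simp only [hx])

lemma densityMeasure_add (hf : AEMeasurable f) :
    densityMeasure f + densityMeasure g
      = volume.withDensity fun x => ENNReal.ofReal (f x) + ENNReal.ofReal (g x) := by
  have h : densityMeasure f = densityMeasure (hf.mk f) := densityMeasure_congr hf.ae_eq_mk
  rw [h, densityMeasure, densityMeasure, ← withDensity_add_left hf.measurable_mk.ennreal_ofReal]
  refine withDensity_congr_ae ?_
  filter_upwards [hf.ae_eq_mk] with x hx
  rw [Pi.add_apply, hx]

/-- The dominating measure has Lebesgue density `f + g`, so this is the chain rule for densities; it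
is used with `h = f` and `h = g`. -/
lemma toReal_rnDeriv_mul (hf : Integrable f) (hg : Integrable g) (hf0 : ∀ᵐ x, 0 ≤ f x)
    (hg0 : ∀ᵐ x, 0 ≤ g x) {h : α → ℝ} (hh : Integrable h) (hh0 : ∀ᵐ x, 0 ≤ h x)
    (hac : densityMeasure h ≪ densityMeasure f + densityMeasure g) :
    ∀ᵐ x, ((densityMeasure h).rnDeriv (densityMeasure f + densityMeasure g) x).toReal
      * (f x + g x) = h x := by
  have := isFiniteMeasure_densityMeasure hf
  have := isFiniteMeasure_densityMeasure hg
  have := isFiniteMeasure_densityMeasure hh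
  have hs : AEMeasurable fun x => ENNReal.ofReal (f x) + ENNReal.ofReal (g x) :=
    hf.1.aemeasurable.ennreal_ofReal.add hg.1.aemeasurable.ennreal_ofReal
  have hp := Measure.measurable_rnDeriv (densityMeasure h) (densityMeasure f + densityMeasure g)
  have h1 := Measure.withDensity_rnDeriv_eq _ _ hac
  have h2 : densityMeasure h = volume.withDensity
      ((fun x => ENNReal.ofReal (f x) + ENNReal.ofReal (g x))
        * (densityMeasure h).rnDeriv (densityMeasure f + densityMeasure g)) := by
    rw [withDensity_mul₀ hs hp.aemeasurable, ← densityMeasure_add hf.1.aemeasurable, h1]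
  have h3 := (withDensity_eq_iff hh.1.aemeasurable.ennreal_ofReal
    (hs.mul hp.aemeasurable) hh.lintegral_lt_top.ne).1 h2
  filter_upwards [h3, hf0, hg0, hh0] with x hx hfx hgx hhx
  have h4 := congrArg ENNReal.toReal hx
  rw [Pi.mul_apply, ENNReal.toReal_mul, ← ENNReal.ofReal_add hfx hgx,
    ENNReal.toReal_ofReal hhx, ENNReal.toReal_ofReal (by positivity)] at h4
  rw [h4, mul_comm]

/-- The squared Hellinger distance of two measures with Lebesgue densities. -/
theorem hellingerDist_densityMeasure_sq (hf : Integrable f) (hg : Integrable g)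
    (hf0 : ∀ᵐ x, 0 ≤ f x) (hg0 : ∀ᵐ x, 0 ≤ g x) :
    hellingerDist (densityMeasure f) (densityMeasure g) ^ 2 = ∫ x, (√(f x) - √(g x)) ^ 2 := by
  have hs : AEMeasurable fun x => ENNReal.ofReal (f x) + ENNReal.ofReal (g x) :=
    hf.1.aemeasurable.ennreal_ofReal.add hg.1.aemeasurable.ennreal_ofReal
  have hacf : densityMeasure f ≪ densityMeasure f + densityMeasure g :=
    Measure.AbsolutelyContinuous.rfl.add_right _
  have hacg : densityMeasure g ≪ densityMeasure f + densityMeasure g :=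
    Measure.AbsolutelyContinuous.rfl.add_right' _
  rw [hellingerDist, Real.sq_sqrt (integral_nonneg fun _ => sq_nonneg _)]
  have hF := toReal_rnDeriv_mul hf hg hf0 hg0 hf hf0 hacf
  have hG := toReal_rnDeriv_mul hf hg hf0 hg0 hg hg0 hacg
  set p := (densityMeasure f).rnDeriv (densityMeasure f + densityMeasure g)
  set q := (densityMeasure g).rnDeriv (densityMeasure f + densityMeasure g)
  rw [densityMeasure_add hf.1.aemeasurable, integral_withDensity_eq_integral_toReal_smul₀ hs
    (ae_of_all _ fun _ => ENNReal.add_lt_top.2 ⟨ENNReal.ofReal_lt_top, ENNReal.ofReal_lt_top⟩)]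
  refine integral_congr_ae ?_
  filter_upwards [hF, hG, hf0, hg0] with x hfx hgx h1 h2
  have h3 : 0 ≤ f x + g x := add_nonneg h1 h2
  rw [← ENNReal.ofReal_add h1 h2, ENNReal.toReal_ofReal h3, smul_eq_mul]
  have e1 : √(f x) = √(p x).toReal * √(f x + g x) := by
    rw [← Real.sqrt_mul ENNReal.toReal_nonneg, hfx]
  have e2 : √(g x) = √(q x).toReal * √(f x + g x) := by
    rw [← Real.sqrt_mul ENNReal.toReal_nonneg, hgx]
  rw [e1, e2, ← sub_mul, mul_pow, Real.sq_sqrt h3]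
  ring

lemma integrable_sq_sqrt_sub (hf : Integrable f) (hg : Integrable g)
    (hf0 : ∀ᵐ x, 0 ≤ f x) (hg0 : ∀ᵐ x, 0 ≤ g x) :
    Integrable fun x => (√(f x) - √(g x)) ^ 2 := by
  refine (hf.add hg).mono'
    ((hf.1.aemeasurable.sqrt.sub hg.1.aemeasurable.sqrt).pow_const 2).aestronglyMeasurable ?_
  filter_upwards [hf0, hg0] with x h1 h2
  rw [Real.norm_eq_abs, abs_of_nonneg (sq_nonneg _), Pi.add_apply]
  nlinarith [Real.sq_sqrt h1, Real.sq_sqrt h2,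
    mul_nonneg (Real.sqrt_nonneg (f x)) (Real.sqrt_nonneg (g x))]

lemma sq_sqrt_sub_sqrt_le_abs {x y : ℝ} (hx : 0 ≤ x) (hy : 0 ≤ y) : (√x - √y) ^ 2 ≤ |x - y| := by
  have e : x - y = (√x - √y) * (√x + √y) := by
    nlinarith [Real.sq_sqrt hx, Real.sq_sqrt hy]
  rw [e, abs_mul, ← sq_abs, sq]
  refine mul_le_mul_of_nonneg_left ?_ (abs_nonneg _)
  have h1 := Real.sqrt_nonneg x
  have h2 := Real.sqrt_nonneg y
  rw [abs_of_nonneg (by positivity : 0 ≤ √x + √y), abs_le]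
  constructor <;> linarith

/-- The squared Hellinger distance is bounded by the `L¹` distance. -/
lemma hellingerDist_sq_le_distL1 (hf : Integrable f) (hg : Integrable g)
    (hf0 : ∀ᵐ x, 0 ≤ f x) (hg0 : ∀ᵐ x, 0 ≤ g x) :
    hellingerDist (densityMeasure f) (densityMeasure g) ^ 2 ≤ distL1 f g := by
  rw [hellingerDist_densityMeasure_sq hf hg hf0 hg0]
  refine integral_mono_ae (integrable_sq_sqrt_sub hf hg hf0 hg0) (hf.sub hg).abs ?_
  filter_upwards [hf0, hg0] with x h1 h2 using sq_sqrt_sub_sqrt_le_abs h1 h2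

lemma integral_sq_sqrt_sub (hf : Integrable f) (hg : Integrable g)
    (hf0 : ∀ᵐ x, 0 ≤ f x) (hg0 : ∀ᵐ x, 0 ≤ g x) :
    ∫ x, (√(f x) - √(g x)) ^ 2 = (∫ x, f x) + (∫ x, g x) - 2 * ∫ x, √(f x) * √(g x) := by
  have hi : Integrable fun x => √(f x) * √(g x) := by
    refine (hf.add hg).mono'
      (hf.1.aemeasurable.sqrt.mul hg.1.aemeasurable.sqrt).aestronglyMeasurable ?_
    filter_upwards [hf0, hg0] with x h1 h2
    rw [Real.norm_eq_abs, abs_of_nonneg (by positivity), Pi.add_apply]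
    nlinarith [Real.sq_sqrt h1, Real.sq_sqrt h2, sq_nonneg (√(f x) - √(g x))]
  have hfg : Integrable fun x => f x + g x := hf.add hg
  rw [← integral_add hf hg, ← integral_const_mul, ← integral_sub hfg (hi.const_mul 2)]
  refine integral_congr_ae ?_
  filter_upwards [hf0, hg0] with x h1 h2
  nlinarith [Real.sq_sqrt h1, Real.sq_sqrt h2]

/-- Normalizing the first density at most doubles the squared Hellinger distance to a probability
density. -/
lemma integral_sq_sqrt_sub_div_le (hf : Integrable f) (hf0 : ∀ᵐ x, 0 ≤ f x)
    (hg : IsProbDensity g) (hpos : 0 < ∫ x, f x) :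
    ∫ x, (√(f x / ∫ x, f x) - √(g x)) ^ 2 ≤ 2 * ∫ x, (√(f x) - √(g x)) ^ 2 := by
  set t := ∫ x, f x with ht
  have hs : 0 < √t := Real.sqrt_pos.2 hpos
  have hst := Real.sq_sqrt hpos.le
  have h0 : 0 ≤ ∫ x, (√(f x / t) - √(g x)) ^ 2 := integral_nonneg fun _ => sq_nonneg _
  have hB : 0 ≤ ∫ x, √(f x) * √(g x) := integral_nonneg fun _ => by positivity
  rw [integral_sq_sqrt_sub (hf.div_const t) hg.integrable
    (hf0.mono fun x hx => div_nonneg hx hpos.le) hg.nonneg, integral_div, hg.integral_eq_one,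
    ← ht, div_self hpos.ne'] at h0 ⊢
  rw [integral_sq_sqrt_sub hf hg.integrable hf0 hg.nonneg, hg.integral_eq_one, ← ht]
  have e : ∫ x, √(f x / t) * √(g x) = (∫ x, √(f x) * √(g x)) / √t := by
    rw [← integral_div]
    refine integral_congr_ae (ae_of_all _ fun x => ?_)
    simp only [Real.sqrt_div' _ hpos.le]
    ring
  rw [e] at h0 ⊢
  set B := ∫ x, √(f x) * √(g x) with hB_def
  obtain ⟨β, hβ⟩ : ∃ β, β = B / √t := ⟨_, rfl⟩
  have hBβ : B = β * √t := by rw [hβ]; field_simp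
  have hβ0 : 0 ≤ β := by rw [hβ]; positivity
  rw [← hβ] at h0 ⊢
  rw [hBβ]
  -- The claim is `1 - β ≤ t + 1 - 2 β √t`. The right side equals `(√t - β)² + (1 - β)(1 + β)`, and
  -- `0 ≤ β ≤ 1`, the upper bound coming from `h0`.
  nlinarith [sq_nonneg (√t - β), mul_nonneg hβ0 (by linarith : 0 ≤ 1 - β)]

end Hellinger

/-! ### The pointwise inequality. -/

section Pointwise

/-- Put `d = |α s - β t|`. The estimates `1 - β / α ≤ log α - log β ≤ α / β - 1` trade the logarithm
for `α - β`; which one is useful depends on the sign of `α s - β t`. -/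
lemma sq_sub_le_of_le {α β s t : ℝ} (hβ : 0 < β) (hαβ : β ≤ α) (hs : 0 ≤ s) (ht : 0 ≤ t) :
    (α * s - β * t) ^ 2 ≤ 2 * (Real.log α - Real.log β) * ((α * s) ^ 2 - (β * t) ^ 2)
      + 4 / 3 * α ^ 2 * (s - t) ^ 2 := by
  have hα : 0 < α := hβ.trans_le hαβ
  set G := Real.log α - Real.log β with hG
  have hG1 : α - β ≤ α * G := by
    have := Real.one_sub_inv_le_log_of_pos (div_pos hα hβ)
    rw [Real.log_div hα.ne' hβ.ne', inv_div] at this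
    calc α - β = α * (1 - β / α) := by field_simp
      _ ≤ _ := mul_le_mul_of_nonneg_left this hα.le
  have hG2 : β * G ≤ α - β := by
    have := Real.log_le_sub_one_of_pos (div_pos hα hβ)
    rw [Real.log_div hα.ne' hβ.ne'] at this
    calc β * G ≤ β * (α / β - 1) := mul_le_mul_of_nonneg_left this hβ.le
      _ = _ := by field_simp
  have hG0 : 0 ≤ G := sub_nonneg.2 (Real.log_le_log hβ hαβ)
  rcases le_total (β * t) (α * s) with h | h
  · obtain ⟨d, hd⟩ : ∃ d, d = α * s - β * t := ⟨_, rfl⟩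
    have hd0 : 0 ≤ d := by linarith
    have h1 : (α - β) * (s * d) ≤ α * G * (s * d) :=
      mul_le_mul_of_nonneg_right hG1 (mul_nonneg hs hd0)
    have h2 : 0 ≤ G * (d * (β * t)) := by positivity
    have h3 : β ^ 2 * (s - t) ^ 2 ≤ 4 / 3 * α ^ 2 * (s - t) ^ 2 :=
      mul_le_mul_of_nonneg_right (by nlinarith) (sq_nonneg _)
    have h4 : d ^ 2 = (α - β) * (s * d) + d * (β * (s - t)) := by
      rw [show d ^ 2 = (α * s - β * t) * d by rw [hd]; ring]; ring
    have h5 : 2 * G * ((α * s) ^ 2 - (β * t) ^ 2)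
        = 2 * (α * G * (s * d)) + 2 * (G * (d * (β * t))) := by rw [hd]; ring
    rw [h5, ← hd]
    -- Here the logarithmic term is nonnegative and is at least `2 d² - 2 d β (s - t)`; completing
    -- the square needs only `β² (s - t)²`.
    nlinarith [sq_nonneg (d - β * (s - t))]
  · obtain ⟨d, hd⟩ : ∃ d, d = β * t - α * s := ⟨_, rfl⟩
    have hd0 : 0 ≤ d := by linarith
    have h1 : β * G * (t * d) ≤ (α - β) * (t * d) :=
      mul_le_mul_of_nonneg_right hG2 (mul_nonneg ht hd0)
    have h2 : 0 ≤ G * (d * d) := by positivity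
    have h3 : (α - β) * (t * d) = α * (t - s) * d - d ^ 2 := by
      rw [show d ^ 2 = (β * t - α * s) * d by rw [hd]; ring]; ring
    have h5 : 2 * G * ((α * s) ^ 2 - (β * t) ^ 2)
        = -(4 * (β * G * (t * d))) + 2 * (G * (d * d)) := by rw [hd]; ring
    rw [h5, show (α * s - β * t) ^ 2 = d ^ 2 by rw [hd]; ring]
    -- Here the logarithmic term is nonpositive. With `x = α (t - s)`, what is left is `3 d² - 4 x d
    -- + (4/3) x² = (3 d - 2 x)² / 3`, which is where `4/3` comes from.
    nlinarith [sq_nonneg (3 * d - 2 * (α * (t - s)))]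

/-- The pointwise inequality behind the stability of bridges. -/
lemma sq_sqrt_mul_sub_le {A B C s t : ℝ} (hA : 0 < A) (hB : 0 < B) (hAC : A ≤ C) (hBC : B ≤ C)
    (hs : 0 ≤ s) (ht : 0 ≤ t) :
    (√(A * s) - √(B * t)) ^ 2 ≤
      (Real.log A - Real.log B) * (A * s - B * t) + 4 / 3 * C * (√s - √t) ^ 2 := by
  have key {A B s t : ℝ} (hB : 0 < B) (hBA : B ≤ A) (hs : 0 ≤ s) (ht : 0 ≤ t) :
      (√(A * s) - √(B * t)) ^ 2 ≤
        (Real.log A - Real.log B) * (A * s - B * t) + 4 / 3 * A * (√s - √t) ^ 2 := by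
    have hA : 0 < A := hB.trans_le hBA
    have h := sq_sub_le_of_le (Real.sqrt_pos.2 hB) (Real.sqrt_le_sqrt hBA)
      (Real.sqrt_nonneg s) (Real.sqrt_nonneg t)
    rw [mul_pow, mul_pow, Real.sq_sqrt hA.le, Real.sq_sqrt hB.le, Real.sq_sqrt hs,
      Real.sq_sqrt ht, Real.log_sqrt hA.le, Real.log_sqrt hB.le] at h
    rw [Real.sqrt_mul hA.le, Real.sqrt_mul hB.le]
    linarith
  rcases le_total B A with h | h
  · have := key hB h hs ht
    have h1 := mul_le_mul_of_nonneg_right hAC (sq_nonneg (√s - √t))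
    linarith
  · have := key hA h ht hs
    have h1 := mul_le_mul_of_nonneg_right hBC (sq_nonneg (√s - √t))
    nlinarith

end Pointwise

/-! ### Stability of bridges in Hellinger distance. -/

section Stability

variable {X Y : Type*} [MeasureSpace X] [MeasureSpace Y]
  {K : ℝ} {ρ₀ ρ₀' : X → ℝ} {ρ₁ ρ₁' : Y → ℝ} {φ φ' : X × Y → ℝ} {a a' : X → ℝ} {b b' : Y → ℝ}
  {l u l' u' : ℝ}

lemma scaledMeasure_densityMeasure (hφ : AEMeasurable φ) (ha : IsPosBdd l u a)
    (hb : IsPosBdd l' u' b) :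
    scaledMeasure (densityMeasure φ) a b = densityMeasure fun p => a p.1 * b p.2 * φ p := by
  rw [scaledMeasure, densityMeasure, densityMeasure,
    ← withDensity_mul₀ hφ.ennreal_ofReal (measurable_scaling ha hb).aemeasurable]
  congr 1
  ext p
  rw [Pi.mul_apply, mul_comm, ← ENNReal.ofReal_mul (mul_pos (ha.pos _) (hb.pos _)).le]

lemma IsPosBdd.integrable_scaling (ha : IsPosBdd l u a) (hb : IsPosBdd l' u' b)
    (hφ : Integrable φ) : Integrable fun p : X × Y => a p.1 * b p.2 * φ p := by
  have h := (ha.comp (measurable_fst (β := Y))).mul (hb.comp (measurable_snd (α := X)))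
  exact hφ.bdd_mul h.measurable.aestronglyMeasurable (ae_of_all _ h.abs_le)

lemma integral_mul_sub_le {α : Type*} [MeasureSpace α] {C : ℝ} {F f g : α → ℝ}
    (hF : Measurable F) (hFC : ∀ x, |F x| ≤ C) (hf : Integrable f) (hg : Integrable g) :
    (∫ x, f x * F x) - ∫ x, g x * F x ≤ C * distL1 f g := by
  have i1 : Integrable fun x => f x * F x :=
    hf.mul_bdd hF.aestronglyMeasurable (ae_of_all _ hFC)
  have i2 : Integrable fun x => g x * F x :=
    hg.mul_bdd hF.aestronglyMeasurable (ae_of_all _ hFC)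
  rw [← integral_sub i1 i2, distL1, ← integral_const_mul]
  refine integral_mono (i1.sub i2) ((hf.sub hg).abs.const_mul C) fun x => ?_
  calc f x * F x - g x * F x = F x * (f x - g x) := by ring
    _ ≤ |F x * (f x - g x)| := le_abs_self _
    _ = |F x| * |f x - g x| := abs_mul _ _
    _ ≤ C * |f x - g x| := mul_le_mul_of_nonneg_right (hFC x) (abs_nonneg _)

lemma abs_log_sub_log_le {x y c : ℝ} (hx : Real.exp (-c) ≤ x) (hx' : x ≤ Real.exp c)
    (hy : Real.exp (-c) ≤ y) (hy' : y ≤ Real.exp c) : |Real.log x - Real.log y| ≤ 2 * c := by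
  have px := (Real.exp_pos _).trans_le hx
  have py := (Real.exp_pos _).trans_le hy
  have h1 := (Real.le_log_iff_exp_le px).2 hx
  have h2 := (Real.log_le_iff_le_exp px).2 hx'
  have h3 := (Real.le_log_iff_exp_le py).2 hy
  have h4 := (Real.log_le_iff_le_exp py).2 hy'
  rw [abs_le]; constructor <;> linarith

/-- Testing a coupling density against a sum of one-variable functions. -/
lemma integral_scaling_mul_add (hρ₀ : IsProbDensity ρ₀) (hρ₁ : IsProbDensity ρ₁)
    (hφ : Integrable φ) (hφ0 : ∀ᵐ p, 0 ≤ φ p) (h : IsPotentialPair K ρ₀ ρ₁ φ a b)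
    {F : X → ℝ} {G : Y → ℝ} {C D : ℝ} (hF : Measurable F) (hG : Measurable G)
    (hFC : ∀ x, |F x| ≤ C) (hGD : ∀ y, |G y| ≤ D) :
    ∫ p, a p.1 * b p.2 * φ p * (F p.1 + G p.2) = (∫ x, ρ₀ x * F x) + ∫ y, ρ₁ y * G y := by
  have := hρ₀.isProbabilityMeasure
  have := hρ₁.isProbabilityMeasure
  have h0 : ∀ᵐ p : X × Y, 0 ≤ a p.1 * b p.2 * φ p := by
    filter_upwards [hφ0] with p hp
    exact mul_nonneg (mul_pos (h.fst.pos _) (h.snd.pos _)).le hp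
  rw [← integral_densityMeasure (h.fst.integrable_scaling h.snd hφ).1.aemeasurable h0,
    ← scaledMeasure_densityMeasure hφ.1.aemeasurable h.fst h.snd,
    integral_add
      (h.coupling.integrable_fst (Integrable.of_bound hF.aestronglyMeasurable C (ae_of_all _ hFC)))
      (h.coupling.integrable_snd (Integrable.of_bound hG.aestronglyMeasurable D (ae_of_all _ hGD))),
    h.coupling.integral_fst hF, h.coupling.integral_snd hG,
    integral_densityMeasure hρ₀.integrable.1.aemeasurable hρ₀.nonneg,
    integral_densityMeasure hρ₁.integrable.1.aemeasurable hρ₁.nonneg]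

/-- Quantitative stability of couplings of product form. -/
theorem integral_sq_sqrt_coupling_sub_le (hρ₀ : IsProbDensity ρ₀) (hρ₁ : IsProbDensity ρ₁)
    (hρ₀' : IsProbDensity ρ₀') (hρ₁' : IsProbDensity ρ₁')
    (hφ : Integrable φ) (hφ0 : ∀ᵐ p, 0 ≤ φ p) (hφ' : Integrable φ') (hφ0' : ∀ᵐ p, 0 ≤ φ' p)
    (h : IsPotentialPair K ρ₀ ρ₁ φ a b) (h' : IsPotentialPair K ρ₀' ρ₁' φ' a' b') :
    ∫ p, (√(a p.1 * b p.2 * φ p) - √(a' p.1 * b' p.2 * φ' p)) ^ 2 ≤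
      2 * K * distL1 ρ₀ ρ₀' + 4 * K * distL1 ρ₁ ρ₁'
        + 4 / 3 * Real.exp (3 * K) * ∫ p, (√(φ p) - √(φ' p)) ^ 2 := by
  set F : X → ℝ := fun x => Real.log (a x) - Real.log (a' x) with hF_def
  set G : Y → ℝ := fun y => Real.log (b y) - Real.log (b' y) with hG_def
  have hF : Measurable F := h.fst.measurable_log.sub h'.fst.measurable_log
  have hG : Measurable G := h.snd.measurable_log.sub h'.snd.measurable_log
  have hFC (x : X) : |F x| ≤ 2 * K :=
    abs_log_sub_log_le (h.fst.lower x) (h.fst.upper x) (h'.fst.lower x) (h'.fst.upper x)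
  have hGD (y : Y) : |G y| ≤ 4 * K := by
    have := abs_log_sub_log_le (h.snd.lower y) (h.snd.upper y) (h'.snd.lower y) (h'.snd.upper y)
    linarith
  have hFG : Measurable fun p : X × Y => F p.1 + G p.2 :=
    (hF.comp measurable_fst).add (hG.comp measurable_snd)
  have hFGb (p : X × Y) : ‖F p.1 + G p.2‖ ≤ 2 * K + 4 * K :=
    (norm_add_le _ _).trans (add_le_add (hFC _) (hGD _))
  have j1 := h.fst.integrable_scaling h.snd hφ
  have j2 := h'.fst.integrable_scaling h'.snd hφ'
  have n1 : ∀ᵐ p : X × Y, 0 ≤ a p.1 * b p.2 * φ p := by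
    filter_upwards [hφ0] with p hp
    exact mul_nonneg (mul_pos (h.fst.pos _) (h.snd.pos _)).le hp
  have n2 : ∀ᵐ p : X × Y, 0 ≤ a' p.1 * b' p.2 * φ' p := by
    filter_upwards [hφ0'] with p hp
    exact mul_nonneg (mul_pos (h'.fst.pos _) (h'.snd.pos _)).le hp
  have i1 : Integrable fun p : X × Y => a p.1 * b p.2 * φ p * (F p.1 + G p.2) :=
    j1.mul_bdd hFG.aestronglyMeasurable (ae_of_all _ hFGb)
  have i2 : Integrable fun p : X × Y => a' p.1 * b' p.2 * φ' p * (F p.1 + G p.2) :=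
    j2.mul_bdd hFG.aestronglyMeasurable (ae_of_all _ hFGb)
  have i3 : Integrable fun p : X × Y => 4 / 3 * Real.exp (3 * K) * (√(φ p) - √(φ' p)) ^ 2 :=
    (integrable_sq_sqrt_sub hφ hφ' hφ0 hφ0').const_mul _
  have hmain : ∫ p, (√(a p.1 * b p.2 * φ p) - √(a' p.1 * b' p.2 * φ' p)) ^ 2 ≤
      ∫ p : X × Y, ((a p.1 * b p.2 * φ p * (F p.1 + G p.2)
        - a' p.1 * b' p.2 * φ' p * (F p.1 + G p.2))
        + 4 / 3 * Real.exp (3 * K) * (√(φ p) - √(φ' p)) ^ 2) := by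
    refine integral_mono_ae (integrable_sq_sqrt_sub j1 j2 n1 n2) ((i1.sub i2).add i3) ?_
    filter_upwards [hφ0, hφ0'] with p hp hp'
    have pa := h.fst.pos p.1
    have pb := h.snd.pos p.2
    have pa' := h'.fst.pos p.1
    have pb' := h'.snd.pos p.2
    refine (sq_sqrt_mul_sub_le (mul_pos pa pb) (mul_pos pa' pb') (h.mul_le p.1 p.2)
      (h'.mul_le p.1 p.2) hp hp').trans_eq ?_
    rw [Real.log_mul pa.ne' pb.ne', Real.log_mul pa'.ne' pb'.ne', hF_def, hG_def]
    ring
  have hF1 := integral_mul_sub_le hF hFC hρ₀.integrable hρ₀'.integrable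
  have hG1 := integral_mul_sub_le hG hGD hρ₁.integrable hρ₁'.integrable
  have i12 : Integrable fun p : X × Y => a p.1 * b p.2 * φ p * (F p.1 + G p.2)
      - a' p.1 * b' p.2 * φ' p * (F p.1 + G p.2) := i1.sub i2
  rw [integral_add i12 i3, integral_sub i1 i2, integral_const_mul,
    integral_scaling_mul_add hρ₀ hρ₁ hφ hφ0 h hF hG hFC hGD,
    integral_scaling_mul_add hρ₀' hρ₁' hφ' hφ0' h' hF hG hFC hGD] at hmain
  linarith

variable [SigmaFinite (volume : Measure Y)]

/-- Under a bounded ratio after normalization by `s > 0`, the bridge exists, is unique and has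
product form. -/
theorem HasBoundedRatio.exists_bridge {s : ℝ} (hs : 0 < s) (hK : 0 ≤ K)
    (h : HasBoundedRatio K ρ₀ ρ₁ fun p => φ p / s) :
    ∃ a b, IsPotentialPair K ρ₀ ρ₁ (fun p => φ p / s) a b ∧
      IsBridge (densityMeasure ρ₀) (densityMeasure ρ₁) (densityMeasure φ)
        (densityMeasure fun p => a p.1 * b p.2 * (φ p / s)) ∧
      ∀ π, IsBridge (densityMeasure ρ₀) (densityMeasure ρ₁) (densityMeasure φ) π →
        π = densityMeasure fun p => a p.1 * b p.2 * (φ p / s) := by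
  have := h.fst.isProbabilityMeasure
  have := h.snd.isProbabilityMeasure
  obtain ⟨a, b, hab⟩ := h.exists_isPotentialPair hK
  have hφ : Integrable φ := by
    refine (h.integrable.mul_const s).congr (ae_of_all _ fun p => ?_)
    simp only; field_simp
  have := isFiniteMeasure_densityMeasure hφ
  -- Rescaling the reference does not change the bridge: the factor `s⁻¹` is absorbed into `a`.
  have ha := hab.fst.const_mul (inv_pos.2 hs)
  have e1 : scaledMeasure (densityMeasure φ) (fun x => s⁻¹ * a x) b
      = densityMeasure fun p => a p.1 * b p.2 * (φ p / s) := by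
    rw [scaledMeasure_densityMeasure hφ.1.aemeasurable ha hab.snd]
    congr 1
    ext p
    ring
  have e2 := scaledMeasure_densityMeasure h.integrable.1.aemeasurable hab.fst hab.snd
  have hc := hab.coupling
  rw [e2, ← e1] at hc
  have hbr := isBridge_scaledMeasure ha hab.snd hc
  rw [e1] at hbr
  exact ⟨a, b, hab, hbr⟩

theorem HasBoundedRatio.existsUnique_bridge {s : ℝ} (hs : 0 < s) (hK : 0 ≤ K)
    (h : HasBoundedRatio K ρ₀ ρ₁ fun p => φ p / s) :
    ∃! π, IsBridge (densityMeasure ρ₀) (densityMeasure ρ₁) (densityMeasure φ) π :=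
  have ⟨_, _, _, h1, h2⟩ := h.exists_bridge hs hK
  ⟨_, h1, h2⟩

/-- Stability of static Schrödinger bridges in Hellinger distance. -/
theorem hellingerDist_bridge_sq_le {π π' : Measure (X × Y)} (hK : 0 ≤ K)
    (hφ : Integrable φ) (hpos : 0 < ∫ p, φ p) (hφ' : IsProbDensity φ')
    (h : HasBoundedRatio K ρ₀ ρ₁ fun p => φ p / ∫ p, φ p) (h' : HasBoundedRatio K ρ₀' ρ₁' φ')
    (hπ : IsBridge (densityMeasure ρ₀) (densityMeasure ρ₁) (densityMeasure φ) π)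
    (hπ' : IsBridge (densityMeasure ρ₀') (densityMeasure ρ₁') (densityMeasure φ') π') :
    hellingerDist π π' ^ 2 ≤ 4 * K * (distL1 ρ₀ ρ₀' + distL1 ρ₁ ρ₁')
      + 8 / 3 * Real.exp (3 * K) * hellingerDist (densityMeasure φ) (densityMeasure φ') ^ 2 := by
  have hφ0 : ∀ᵐ p, 0 ≤ φ p := by
    filter_upwards [h.pos] with p hp
    exact ((div_pos_iff_of_pos_right hpos).1 hp).le
  have hφn : ∀ᵐ p, 0 ≤ φ p / ∫ p, φ p := h.pos.mono fun p hp => hp.le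
  obtain ⟨a, b, hab, -, huniq⟩ := h.exists_bridge hpos hK
  have e1 : (fun p => φ' p / (1 : ℝ)) = φ' := by ext p; rw [div_one]
  obtain ⟨a', b', hab', -, huniq'⟩ :=
    HasBoundedRatio.exists_bridge (φ := φ') one_pos hK (by rwa [e1])
  rw [e1] at hab'
  simp only [div_one] at huniq'
  have nn {a : X → ℝ} {b : Y → ℝ} {f : X × Y → ℝ} {ρ ρ'} (hp : IsPotentialPair K ρ ρ' f a b)
      (hf : ∀ᵐ p, 0 ≤ f p) : ∀ᵐ p : X × Y, 0 ≤ a p.1 * b p.2 * f p := by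
    filter_upwards [hf] with p hfp
    exact mul_nonneg (mul_pos (hp.fst.pos _) (hp.snd.pos _)).le hfp
  rw [huniq π hπ, huniq' π' hπ',
    hellingerDist_densityMeasure_sq (hab.fst.integrable_scaling hab.snd h.integrable)
      (hab'.fst.integrable_scaling hab'.snd hφ'.integrable) (nn hab hφn) (nn hab' hφ'.nonneg),
    hellingerDist_densityMeasure_sq hφ hφ'.integrable hφ0 hφ'.nonneg]
  have h1 := integral_sq_sqrt_coupling_sub_le h.fst h.snd h'.fst h'.snd h.integrable hφn
    hφ'.integrable hφ'.nonneg hab hab'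
  have h2 := integral_sq_sqrt_sub_div_le hφ hφ0 hφ' hpos
  have h3 : 0 ≤ distL1 ρ₀ ρ₀' := integral_nonneg fun _ => abs_nonneg _
  have h4 := mul_le_mul_of_nonneg_left h2
    (by positivity : 0 ≤ 4 / 3 * Real.exp (3 * K))
  have h5 := mul_nonneg hK h3
  linarith

end Stability

/-! ### Histogram densities on the unit interval and square. -/

section Histogram

/-- The `i`-th of the `m` cells into which `[0,1]` is divided. -/
def cell (m i : ℕ) : Set unitInterval := {x | ⌈(m : ℝ) * (x : ℝ)⌉₊ = i + 1}

lemma measurableSet_cell (m i : ℕ) : MeasurableSet (cell m i) := by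
  have : Measurable fun x : unitInterval => ⌈(m : ℝ) * (x : ℝ)⌉₊ :=
    Nat.measurable_ceil.comp (measurable_subtype_coe.const_mul (m : ℝ))
  exact this (MeasurableSet.singleton (i + 1))

lemma volume_cell {m i : ℕ} (h : i < m) : volume.real (cell m i) = (m : ℝ)⁻¹ := by
  have hm : (0 : ℝ) < m := by exact_mod_cast (Nat.zero_le i).trans_lt h
  have hi : ((i : ℝ) + 1) ≤ m := by exact_mod_cast h
  have e : cell m i = Set.Ioc (⟨i / m, by positivity, (div_le_one hm).2 (by linarith)⟩ : unitInterval)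
      ⟨(i + 1) / m, by positivity, (div_le_one hm).2 hi⟩ := by
    ext x
    simp only [cell, Set.mem_ofPred_eq, Set.mem_Ioc, ← Subtype.coe_lt_coe, ← Subtype.coe_le_coe]
    rw [Nat.ceil_eq_iff (Nat.succ_ne_zero i), div_lt_iff₀ hm, le_div_iff₀ hm, mul_comm (m : ℝ)]
    simp
  rw [Measure.real, e, unitInterval.volume_Ioc, ENNReal.toReal_ofReal]
  · simp only; field_simp; ring
  · simp only; rw [← sub_div]; simp

lemma exists_mem_cell {m : ℕ} (hm : 0 < m) {x : unitInterval} (hx : 0 < (x : ℝ)) :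
    ∃ i : Fin m, ⌈(m : ℝ) * (x : ℝ)⌉₊ = (i : ℕ) + 1 := by
  have hm' : (0 : ℝ) < m := by exact_mod_cast hm
  have h1 : 0 < ⌈(m : ℝ) * (x : ℝ)⌉₊ := Nat.ceil_pos.2 (by positivity)
  have h2 : ⌈(m : ℝ) * (x : ℝ)⌉₊ ≤ m := Nat.ceil_le.2 (by nlinarith [x.2.2])
  exact ⟨⟨⌈(m : ℝ) * (x : ℝ)⌉₊ - 1, by omega⟩, by simp only; omega⟩

/-- The cells are half-open, `(i / m, (i + 1) / m]`, and miss only the null point `0`. -/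
lemma ae_coe_pos : ∀ᵐ x : unitInterval, 0 < (x : ℝ) := by
  have : ∀ᵐ x : unitInterval, x ≠ 0 := by
    rw [ae_iff]; simp
  filter_upwards [this] with x hx
  exact lt_of_le_of_ne x.2.1 fun h => hx (Subtype.ext h.symm)

variable {m n : ℕ} {v : Fin m → ℝ} {L : Matrix (Fin m) (Fin n) ℝ} {N : ℝ}

lemma marginDensity_of_ceil {x : unitInterval} {i : Fin m}
    (h : ⌈(m : ℝ) * (x : ℝ)⌉₊ = (i : ℕ) + 1) :
    marginDensity v x = m / (∑ i, v i) * v i := by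
  rw [marginDensity]
  congr 1
  rw [Finset.sum_eq_single i]
  · rw [if_pos h]
  · intro j _ hj
    rw [if_neg]
    intro h'
    exact hj (Fin.ext (by omega))
  · simp

lemma kernelDensity_of_ceil {p : unitInterval × unitInterval} {i : Fin m} {j : Fin n}
    (h : ⌈(m : ℝ) * (p.1 : ℝ)⌉₊ = (i : ℕ) + 1) (h' : ⌈(n : ℝ) * (p.2 : ℝ)⌉₊ = (j : ℕ) + 1) :
    kernelDensity N L p = (n * m : ℝ) / N * L i j := by
  rw [kernelDensity, Finset.sum_eq_single i, Finset.sum_eq_single j]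
  · rw [if_pos ⟨h, h'⟩]
  · intro j' _ hj
    rw [if_neg]
    rintro ⟨-, h2⟩
    exact hj (Fin.ext (by omega))
  · simp
  · intro i' _ hi
    refine Finset.sum_eq_zero fun j' _ => ?_
    rw [if_neg]
    rintro ⟨h2, -⟩
    exact hi (Fin.ext (by omega))
  · simp

lemma marginDensity_eq_indicator (v : Fin m → ℝ) : marginDensity v = fun x =>
    m / (∑ i, v i) * ∑ i : Fin m, (cell m i).indicator (fun _ => v i) x := by
  ext x
  simp only [marginDensity, Set.indicator_apply, cell, Set.mem_ofPred_eq]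

lemma kernelDensity_eq_indicator (N : ℝ) (L : Matrix (Fin m) (Fin n) ℝ) :
    kernelDensity N L = fun p => (n * m : ℝ) / N * ∑ i : Fin m, ∑ j : Fin n,
      (cell m i ×ˢ cell n j).indicator (fun _ => L i j) p := by
  ext x
  simp only [kernelDensity, Set.indicator_apply, cell, Set.mem_prod, Set.mem_ofPred_eq]

lemma integrable_marginDensity (v : Fin m → ℝ) : Integrable (marginDensity v) := by
  rw [marginDensity_eq_indicator]
  exact (integrable_finsetSum _ fun i _ =>
    (integrable_const (v i)).indicator (measurableSet_cell m i)).const_mul _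

lemma integrable_kernelDensity (N : ℝ) (L : Matrix (Fin m) (Fin n) ℝ) :
    Integrable (kernelDensity N L) := by
  rw [kernelDensity_eq_indicator]
  exact (integrable_finsetSum _ fun i _ => integrable_finsetSum _ fun j _ =>
    (integrable_const (L i j)).indicator
      ((measurableSet_cell m i).prod (measurableSet_cell n j))).const_mul _

lemma integral_marginDensity (hm : 0 < m) (hv : ∑ i, v i ≠ 0) : ∫ x, marginDensity v x = 1 := by
  have hm' : (m : ℝ) ≠ 0 := by exact_mod_cast hm.ne'
  rw [marginDensity_eq_indicator, integral_const_mul, integral_finsetSum _ fun i _ =>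
    (integrable_const (v i)).indicator (measurableSet_cell m i)]
  have (i : Fin m) : ∫ x, (cell m i).indicator (fun _ => v i) x = (m : ℝ)⁻¹ * v i := by
    rw [integral_indicator_const _ (measurableSet_cell m i), volume_cell i.2, smul_eq_mul]
  simp only [this]
  rw [← Finset.mul_sum]
  field_simp

lemma integral_kernelDensity (hm : 0 < m) (hn : 0 < n) (N : ℝ) (hL : ∀ i j, 0 < L i j) :
    ∫ p, kernelDensity N L p = entryNorm L / N := by
  have hm' : (m : ℝ) ≠ 0 := by exact_mod_cast hm.ne'
  have hn' : (n : ℝ) ≠ 0 := by exact_mod_cast hn.ne'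
  have hi (i : Fin m) (j : Fin n) :
      Integrable ((cell m i ×ˢ cell n j).indicator fun _ => L i j) :=
    (integrable_const (L i j)).indicator ((measurableSet_cell m i).prod (measurableSet_cell n j))
  have hij (i : Fin m) (j : Fin n) : ∫ p, (cell m i ×ˢ cell n j).indicator (fun _ => L i j) p
      = (m : ℝ)⁻¹ * (n : ℝ)⁻¹ * |L i j| := by
    rw [integral_indicator_const _ ((measurableSet_cell m i).prod (measurableSet_cell n j)),
      Measure.volume_eq_prod, measureReal_prod_prod, volume_cell i.2, volume_cell j.2, smul_eq_mul,
      abs_of_pos (hL i j)]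
  rw [kernelDensity_eq_indicator, integral_const_mul,
    integral_finsetSum _ fun i _ => integrable_finsetSum _ fun j _ => hi i j]
  simp only [integral_finsetSum _ fun j _ => hi _ j, hij, ← Finset.mul_sum]
  rw [entryNorm]
  field_simp

end Histogram

/-! ### Smooth margins and bounded cost imply a bounded ratio. -/

section Smooth

variable {δ K : ℝ} {m n : ℕ} {r : Fin m → ℝ} {c : Fin n → ℝ} {L : Matrix (Fin m) (Fin n) ℝ}

namespace IsSmoothMargin

lemma row_card_pos (h : IsSmoothMargin δ r c) : 0 < m := by
  rcases Nat.eq_zero_or_pos m with rfl | hm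
  · simpa using h.total_pos
  · exact hm

lemma col_total_pos (h : IsSmoothMargin δ r c) : 0 < ∑ j, c j := h.balanced ▸ h.total_pos

lemma col_card_pos (h : IsSmoothMargin δ r c) : 0 < n := by
  rcases Nat.eq_zero_or_pos n with rfl | hn
  · simpa using h.col_total_pos
  · exact hn

lemma le_one (h : IsSmoothMargin δ r c) : δ ≤ 1 := by
  have hm : (0 : ℝ) < m := by exact_mod_cast h.row_card_pos
  have h1 : ∑ _i : Fin m, δ * (∑ i, r i) / m ≤ ∑ i, r i :=
    Finset.sum_le_sum fun i _ => (h.row_bounds i).1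
  rw [Finset.sum_const, Finset.card_univ, Fintype.card_fin, nsmul_eq_mul,
    mul_div_cancel₀ _ hm.ne'] at h1
  exact le_of_mul_le_mul_right (by linarith) h.total_pos

lemma row_pos (h : IsSmoothMargin δ r c) (hδ : 0 < δ) (i : Fin m) : 0 < r i := by
  have hm : (0 : ℝ) < m := by exact_mod_cast h.row_card_pos
  have := h.total_pos
  exact lt_of_lt_of_le (by positivity) (h.row_bounds i).1

lemma col_pos (h : IsSmoothMargin δ r c) (hδ : 0 < δ) (j : Fin n) : 0 < c j := by
  have hn : (0 : ℝ) < n := by exact_mod_cast h.col_card_pos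
  have := h.col_total_pos
  exact lt_of_lt_of_le (by positivity) (h.col_bounds j).1

lemma le_marginDensity_row (h : IsSmoothMargin δ r c) {x : unitInterval} (hx : 0 < (x : ℝ)) :
    δ ≤ marginDensity r x := by
  obtain ⟨i, hi⟩ := exists_mem_cell h.row_card_pos hx
  have hm : (0 : ℝ) < m := by exact_mod_cast h.row_card_pos
  have hN := h.total_pos
  rw [marginDensity_of_ceil hi]
  calc δ = m / (∑ i, r i) * (δ * (∑ i, r i) / m) := by field_simp
    _ ≤ _ := mul_le_mul_of_nonneg_left (h.row_bounds i).1 (by positivity)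

lemma le_marginDensity_col (h : IsSmoothMargin δ r c) {x : unitInterval} (hx : 0 < (x : ℝ)) :
    δ ≤ marginDensity c x := by
  obtain ⟨j, hj⟩ := exists_mem_cell h.col_card_pos hx
  have hn : (0 : ℝ) < n := by exact_mod_cast h.col_card_pos
  have hN := h.col_total_pos
  rw [marginDensity_of_ceil hj]
  calc δ = n / (∑ j, c j) * (δ * (∑ j, c j) / n) := by field_simp
    _ ≤ _ := mul_le_mul_of_nonneg_left (h.col_bounds j).1 (by positivity)

lemma isProbDensity_row (h : IsSmoothMargin δ r c) (hδ : 0 < δ) :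
    IsProbDensity (marginDensity r) where
  integrable := integrable_marginDensity r
  nonneg := ae_coe_pos.mono fun _ hx => hδ.le.trans (h.le_marginDensity_row hx)
  integral_eq_one := integral_marginDensity h.row_card_pos h.total_pos.ne'

lemma isProbDensity_col (h : IsSmoothMargin δ r c) (hδ : 0 < δ) :
    IsProbDensity (marginDensity c) where
  integrable := integrable_marginDensity c
  nonneg := ae_coe_pos.mono fun _ hx => hδ.le.trans (h.le_marginDensity_col hx)
  integral_eq_one := integral_marginDensity h.col_card_pos h.col_total_pos.ne'

lemma integral_kernelDensity_pos (h : IsSmoothMargin δ r c) (hL : ∀ i j, 0 < L i j) :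
    0 < ∫ p, kernelDensity (∑ i, r i) L p := by
  rw [integral_kernelDensity h.row_card_pos h.col_card_pos _ hL]
  have : Nonempty (Fin m) := ⟨⟨0, h.row_card_pos⟩⟩
  have : Nonempty (Fin n) := ⟨⟨0, h.col_card_pos⟩⟩
  refine div_pos ?_ h.total_pos
  exact Finset.sum_pos (fun i _ => Finset.sum_pos (fun j _ => abs_pos.2 (hL i j).ne')
    Finset.univ_nonempty) Finset.univ_nonempty

lemma kernelDensity_bounds (h : IsSmoothMargin δ r c) (hδ : 0 < δ) (hL : ∀ i j, 0 < L i j)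
    (hK : HasBoundedCost K r c L) {p : unitInterval × unitInterval} (h1 : 0 < (p.1 : ℝ))
    (h2 : 0 < (p.2 : ℝ)) :
    Real.exp (-K) * (marginDensity r p.1 * marginDensity c p.2)
        ≤ kernelDensity (∑ i, r i) L p / ∫ p, kernelDensity (∑ i, r i) L p ∧
      kernelDensity (∑ i, r i) L p / ∫ p, kernelDensity (∑ i, r i) L p
        ≤ Real.exp K * (marginDensity r p.1 * marginDensity c p.2) := by
  obtain ⟨i, hi⟩ := exists_mem_cell h.row_card_pos h1
  obtain ⟨j, hj⟩ := exists_mem_cell h.col_card_pos h2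
  have hm : (0 : ℝ) < m := by exact_mod_cast h.row_card_pos
  have hn : (0 : ℝ) < n := by exact_mod_cast h.col_card_pos
  have hint := h.integral_kernelDensity_pos hL
  rw [integral_kernelDensity h.row_card_pos h.col_card_pos _ hL] at hint ⊢
  rw [marginDensity_of_ceil hi, marginDensity_of_ceil hj, kernelDensity_of_ceil hi hj,
    ← h.balanced]
  have hN := h.total_pos
  have hr := h.row_pos hδ i
  have hc := h.col_pos hδ j
  have hLij := hL i j
  have hcost := hK i j
  set N := ∑ i, r i
  have hS : 0 < entryNorm L := by
    have := mul_pos hint hN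
    rwa [div_mul_cancel₀ _ hN.ne'] at this
  set q := r i * c j * entryNorm L / (L i j * N ^ 2) with hq
  have hq0 : 0 < q := by positivity
  -- The normalized kernel divided by the product of the margin densities is the reciprocal of the
  -- quantity inside the logarithm of the cost; the normalization `N` cancels.
  have e1 : (n * m : ℝ) / N * L i j / (entryNorm L / N) =
      q⁻¹ * (m / N * r i * (n / N * c j)) := by
    rw [hq]; field_simp
  rw [e1]
  obtain ⟨l1, l2⟩ := abs_le.1 hcost
  have l1' := (Real.le_log_iff_exp_le hq0).1 l1
  have l2' := (Real.log_le_iff_le_exp hq0).1 l2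
  constructor
  · refine mul_le_mul_of_nonneg_right ?_ (by positivity)
    rw [Real.exp_neg]
    exact inv_anti₀ hq0 l2'
  · refine mul_le_mul_of_nonneg_right ?_ (by positivity)
    rw [← inv_inv (Real.exp K), ← Real.exp_neg]
    exact inv_anti₀ (Real.exp_pos _) l1'

lemma hasBoundedRatio (h : IsSmoothMargin δ r c) (hδ : 0 < δ) (hL : ∀ i j, 0 < L i j)
    (hK : HasBoundedCost K r c L) : HasBoundedRatio K (marginDensity r) (marginDensity c)
      fun p => kernelDensity (∑ i, r i) L p / ∫ p, kernelDensity (∑ i, r i) L p where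
  fst := h.isProbDensity_row hδ
  snd := h.isProbDensity_col hδ
  fst_pos := ae_coe_pos.mono fun _ hx => hδ.trans_le (h.le_marginDensity_row hx)
  snd_pos := ae_coe_pos.mono fun _ hx => hδ.trans_le (h.le_marginDensity_col hx)
  integrable := (integrable_kernelDensity _ L).div_const _
  lower := by
    filter_upwards [ae_comp_fst ae_coe_pos, ae_comp_snd ae_coe_pos] with p h1 h2
      using (h.kernelDensity_bounds hδ hL hK h1 h2).1
  upper := by
    filter_upwards [ae_comp_fst ae_coe_pos, ae_comp_snd ae_coe_pos] with p h1 h2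
      using (h.kernelDensity_bounds hδ hL hK h1 h2).2

lemma nonneg_of_hasBoundedCost (h : IsSmoothMargin δ r c) (hK : HasBoundedCost K r c L) : 0 ≤ K :=
  (abs_nonneg _).trans (hK ⟨0, h.row_card_pos⟩ ⟨0, h.col_card_pos⟩)

end IsSmoothMargin

/-- There are finitely many entries, so some bound always holds. This gives existence of the bridge
even for those `k` where the cost bound `K` fails. -/
lemma exists_hasBoundedCost (r : Fin m → ℝ) (c : Fin n → ℝ) (L : Matrix (Fin m) (Fin n) ℝ) :
    ∃ K, HasBoundedCost K r c L := by
  refine ⟨∑ i, ∑ j, |Real.log (r i * c j * entryNorm L / (L i j * (∑ i, r i) ^ 2))|,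
    fun i j => ?_⟩
  refine le_trans ?_ (Finset.single_le_sum (fun i _ => Finset.sum_nonneg fun j _ => abs_nonneg _)
    (Finset.mem_univ i))
  exact Finset.single_le_sum
    (f := fun j => |Real.log (r i * c j * entryNorm L / (L i j * (∑ i, r i) ^ 2))|)
    (fun j _ => abs_nonneg _) (Finset.mem_univ j)

end Smooth

/-! ### Passing to the limit in `L¹`. -/

section Limit

lemma exists_subseq_tendsto_ae {α : Type*} [MeasureSpace α] {f : ℕ → α → ℝ} {g : α → ℝ}
    (hf : ∀ k, Integrable (f k)) (hg : Integrable g)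
    (h : Tendsto (fun k => distL1 (f k) g) atTop (𝓝 0)) :
    ∃ ns : ℕ → ℕ, StrictMono ns ∧
      ∀ᵐ x, Tendsto (fun k => f (ns k) x) atTop (𝓝 (g x)) := by
  refine TendstoInMeasure.exists_seq_tendsto_ae (tendstoInMeasure_of_tendsto_eLpNorm one_ne_zero
    (fun k => (hf k).1) hg.1 ?_)
  have (k : ℕ) : eLpNorm (f k - g) 1 volume = ENNReal.ofReal (distL1 (f k) g) := by
    rw [eLpNorm_one_eq_lintegral_enorm, ← ofReal_integral_norm_eq_lintegral_enorm ((hf k).sub hg)]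
    rfl
  simp_rw [this]
  simpa using ENNReal.tendsto_ofReal h

lemma tendsto_integral_of_distL1 {α : Type*} [MeasureSpace α] {f : ℕ → α → ℝ} {g : α → ℝ}
    (hf : ∀ k, Integrable (f k)) (hg : Integrable g)
    (h : Tendsto (fun k => distL1 (f k) g) atTop (𝓝 0)) :
    Tendsto (fun k => ∫ x, f k x) atTop (𝓝 (∫ x, g x)) := by
  rw [tendsto_iff_norm_sub_tendsto_zero]
  refine squeeze_zero (fun _ => norm_nonneg _) (fun k => ?_) h
  rw [← integral_sub (hf k) hg]
  exact norm_integral_le_integral_norm _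

/-- The bounded cost condition passes to `L¹` limits of histograms. -/
theorem hasBoundedRatio_of_tendsto {δ K : ℝ} (hδ : 0 < δ) {m n : ℕ → ℕ}
    {r : (k : ℕ) → Fin (m k) → ℝ} {c : (k : ℕ) → Fin (n k) → ℝ}
    {L : (k : ℕ) → Matrix (Fin (m k)) (Fin (n k)) ℝ}
    (hsmooth : ∀ k, IsSmoothMargin δ (r k) (c k)) (hpos : ∀ k i j, 0 < L k i j)
    (hcost : ∀ᶠ k in atTop, HasBoundedCost K (r k) (c k) (L k))
    {ρr ρc : unitInterval → ℝ} {φ : unitInterval × unitInterval → ℝ}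
    (hρr : IsProbDensity ρr) (hρc : IsProbDensity ρc) (hφ : IsProbDensity φ)
    (hlimr : Tendsto (fun k => distL1 (marginDensity (r k)) ρr) atTop (𝓝 0))
    (hlimc : Tendsto (fun k => distL1 (marginDensity (c k)) ρc) atTop (𝓝 0))
    (hlimφ : Tendsto (fun k => distL1 (kernelDensity (∑ i, r k i) (L k)) φ) atTop (𝓝 0)) :
    HasBoundedRatio K ρr ρc φ := by
  obtain ⟨s₁, hs₁, h₁⟩ := exists_subseq_tendsto_ae (fun k => integrable_marginDensity (r k))
    hρr.integrable hlimr
  obtain ⟨s₂, hs₂, h₂⟩ := exists_subseq_tendsto_ae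
    (fun k => integrable_marginDensity (c (s₁ k))) hρc.integrable (hlimc.comp hs₁.tendsto_atTop)
  obtain ⟨s₃, hs₃, h₃⟩ := exists_subseq_tendsto_ae
    (fun k => integrable_kernelDensity (∑ i, r (s₁ (s₂ k)) i) (L (s₁ (s₂ k)))) hφ.integrable
    (hlimφ.comp (hs₁.comp hs₂).tendsto_atTop)
  set s : ℕ → ℕ := fun k => s₁ (s₂ (s₃ k)) with hs_def
  have hs : Tendsto s atTop atTop := (hs₁.comp (hs₂.comp hs₃)).tendsto_atTop
  have hr : ∀ᵐ x, Tendsto (fun k => marginDensity (r (s k)) x) atTop (𝓝 (ρr x)) :=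
    h₁.mono fun x hx => hx.comp (hs₂.comp hs₃).tendsto_atTop
  have hc : ∀ᵐ x, Tendsto (fun k => marginDensity (c (s k)) x) atTop (𝓝 (ρc x)) :=
    h₂.mono fun x hx => hx.comp hs₃.tendsto_atTop
  have hint : Tendsto (fun k => ∫ p, kernelDensity (∑ i, r (s k) i) (L (s k)) p) atTop (𝓝 1) := by
    rw [← hφ.integral_eq_one]
    exact (tendsto_integral_of_distL1 (fun k => integrable_kernelDensity (∑ i, r k i) (L k))
      hφ.integrable hlimφ).comp hs
  have hbd : ∀ᵐ p : unitInterval × unitInterval,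
      Real.exp (-K) * (ρr p.1 * ρc p.2) ≤ φ p ∧ φ p ≤ Real.exp K * (ρr p.1 * ρc p.2) := by
    filter_upwards [ae_comp_fst hr, ae_comp_snd hc, h₃, ae_comp_fst ae_coe_pos,
      ae_comp_snd ae_coe_pos] with p t1 t2 t3 p1 p2
    -- The bounds concern the kernel normalized by its mass, and that mass tends to `1`.
    have t4 := t3.div hint one_ne_zero
    rw [div_one] at t4
    constructor
    · refine le_of_tendsto_of_tendsto ((t1.mul t2).const_mul _) t4 ?_
      filter_upwards [hs.eventually hcost] with k hk
      exact ((hsmooth _).kernelDensity_bounds hδ (hpos _) hk p1 p2).1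
    · refine le_of_tendsto_of_tendsto t4 ((t1.mul t2).const_mul _) ?_
      filter_upwards [hs.eventually hcost] with k hk
      exact ((hsmooth _).kernelDensity_bounds hδ (hpos _) hk p1 p2).2
  refine ⟨hρr, hρc, ?_, ?_, hφ.integrable, hbd.mono fun _ h => h.1, hbd.mono fun _ h => h.2⟩
  · filter_upwards [hr, ae_coe_pos] with x hx hx0
    exact hδ.trans_le (ge_of_tendsto' hx fun k => (hsmooth _).le_marginDensity_row hx0)
  · filter_upwards [hc, ae_coe_pos] with x hx hx0
    exact hδ.trans_le (ge_of_tendsto' hx fun k => (hsmooth _).le_marginDensity_col hx0)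

end Limit

end SchrodingerBridge

end

open SchrodingerBridge

/-! ### Assembly of the main theorem. -/

theorem mainTheorem8
    (δ K : ℝ) (hδ : 0 < δ)
    (m n : ℕ → ℕ) (r : (k : ℕ) → Fin (m k) → ℝ) (c : (k : ℕ) → Fin (n k) → ℝ)
    (L : (k : ℕ) → Matrix (Fin (m k)) (Fin (n k)) ℝ)
    (hsmooth : ∀ k, IsSmoothMargin δ (r k) (c k))
    (hpos : ∀ k i j, 0 < L k i j)
    (hcost : ∀ᶠ k in atTop, HasBoundedCost K (r k) (c k) (L k))
    (ρr ρc : unitInterval → ℝ) (φ : unitInterval × unitInterval → ℝ)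
    (hρr : IsProbDensity ρr) (hρc : IsProbDensity ρc) (hφ : IsProbDensity φ)
    (hlimr : Tendsto (fun k => distL1 (marginDensity (r k)) ρr) atTop (𝓝 0))
    (hlimc : Tendsto (fun k => distL1 (marginDensity (c k)) ρc) atTop (𝓝 0))
    (hlimφ : Tendsto (fun k => distL1 (kernelDensity (∑ i, r k i) (L k)) φ) atTop (𝓝 0)) :
    (∀ k, ∃! π, IsBridge (marginMeasure (r k)) (marginMeasure (c k))
      (kernelMeasure (∑ i, r k i) (L k)) π) ∧
    (∃! π, IsBridge (densityMeasure ρr) (densityMeasure ρc) (densityMeasure φ) π) ∧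
    ∀ (πk : ℕ → Measure (unitInterval × unitInterval))
      (π : Measure (unitInterval × unitInterval)),
      (∀ k, IsBridge (marginMeasure (r k)) (marginMeasure (c k))
        (kernelMeasure (∑ i, r k i) (L k)) (πk k)) →
      IsBridge (densityMeasure ρr) (densityMeasure ρc) (densityMeasure φ) π →
      (∀ k, HasBoundedCost K (r k) (c k) (L k) →
        hellingerDist (πk k) π ^ 2 ≤
          8 * (K + 4 * Real.log δ⁻¹) *
            (distL1 (marginDensity (r k)) ρr + distL1 (marginDensity (c k)) ρc) +
          4 * Real.exp (3 * K) * δ ^ (-12 : ℤ) *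
            hellingerDist (kernelMeasure (∑ i, r k i) (L k)) (densityMeasure φ) ^ 2) ∧
      Tendsto (fun k => hellingerDist (πk k) π) atTop (𝓝 0) := by
  have hR := hasBoundedRatio_of_tendsto hδ hsmooth hpos hcost hρr hρc hφ hlimr hlimc hlimφ
  have hK : 0 ≤ K := by
    obtain ⟨k, hk⟩ := hcost.exists
    exact (hsmooth k).nonneg_of_hasBoundedCost hk
  have hlog : 0 ≤ Real.log δ⁻¹ :=
    Real.log_nonneg ((one_le_inv₀ hδ).2 (hsmooth 0).le_one)
  have hδ12 : 1 ≤ δ ^ (-12 : ℤ) := by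
    rw [zpow_neg]
    exact (one_le_inv₀ (by positivity)).2
      (by exact_mod_cast pow_le_one₀ hδ.le (hsmooth 0).le_one)
  have hkint (k : ℕ) := (hsmooth k).integral_kernelDensity_pos (hpos k)
  refine ⟨fun k => ?_, ?_, fun πk π hπk hπ => ?_⟩
  · obtain ⟨K', hK'⟩ := exists_hasBoundedCost (r k) (c k) (L k)
    exact ((hsmooth k).hasBoundedRatio hδ (hpos k) hK').existsUnique_bridge (hkint k)
      ((hsmooth k).nonneg_of_hasBoundedCost hK')
  · exact HasBoundedRatio.existsUnique_bridge one_pos hK (by simpa only [div_one] using hR)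
  · have hbound (k : ℕ) (hk : HasBoundedCost K (r k) (c k) (L k)) :
        hellingerDist (πk k) π ^ 2 ≤
          8 * (K + 4 * Real.log δ⁻¹) *
            (distL1 (marginDensity (r k)) ρr + distL1 (marginDensity (c k)) ρc) +
          4 * Real.exp (3 * K) * δ ^ (-12 : ℤ) *
            hellingerDist (kernelMeasure (∑ i, r k i) (L k)) (densityMeasure φ) ^ 2 := by
      refine (hellingerDist_bridge_sq_le hK (integrable_kernelDensity _ _) (hkint k) hφ
        ((hsmooth k).hasBoundedRatio hδ (hpos k) hk) hR (hπk k) hπ).trans ?_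
      have h1 : 0 ≤ distL1 (marginDensity (r k)) ρr := integral_nonneg fun _ => abs_nonneg _
      have h2 : 0 ≤ distL1 (marginDensity (c k)) ρc := integral_nonneg fun _ => abs_nonneg _
      refine add_le_add (mul_le_mul_of_nonneg_right (by linarith) (add_nonneg h1 h2))
        (mul_le_mul_of_nonneg_right ?_ (sq_nonneg _))
      have h3 := Real.exp_pos (3 * K)
      have h4 := mul_le_mul_of_nonneg_left hδ12 h3.le
      linarith
    refine ⟨hbound, ?_⟩
    have hH : Tendsto (fun k =>
        hellingerDist (kernelMeasure (∑ i, r k i) (L k)) (densityMeasure φ) ^ 2)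
        atTop (𝓝 0) := by
      -- The squared Hellinger distance is at most the `L¹` distance of the densities, since `(√x -
      -- √y)² ≤ |x - y|`.
      refine squeeze_zero (fun _ => sq_nonneg _) (fun k => ?_) hlimφ
      refine hellingerDist_sq_le_distL1 (integrable_kernelDensity _ _) hφ.integrable ?_ hφ.nonneg
      obtain ⟨K', hK'⟩ := exists_hasBoundedCost (r k) (c k) (L k)
      filter_upwards [((hsmooth k).hasBoundedRatio hδ (hpos k) hK').pos] with p hp
      exact ((div_pos_iff_of_pos_right (hkint k)).1 hp).le
    have hsq : Tendsto (fun k => hellingerDist (πk k) π ^ 2) atTop (𝓝 0) := by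
      have hlim := ((hlimr.add hlimc).const_mul (8 * (K + 4 * Real.log δ⁻¹))).add
        (hH.const_mul (4 * Real.exp (3 * K) * δ ^ (-12 : ℤ)))
      simp only [add_zero, mul_zero] at hlim
      exact squeeze_zero' (Eventually.of_forall fun _ => sq_nonneg _) (hcost.mono hbound) hlim
    have := hsq.sqrt
    rw [Real.sqrt_zero] at this
    exact this.congr fun k => Real.sqrt_sq (Real.sqrt_nonneg _)
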